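/- **Setting.** Let $A$ be an affine space over a real vector space $L$, and let $\theta:A\times L\to\mathbb{R}$ be linear in the second argument with $\theta(\eta+\xi,\tau)=\theta(\eta,\tau)+[\xi,\tau]$ for a bilinear form $[\cdot,\cdot]:L\times L\to\mathbb{R}$. Put $\omega(\xi,\tau)=\frac12[\xi,\tau]-\frac12[\tau,\xi]$, $M=\{\tau:[\xi,\tau]=0\ \forall\xi\}$, $N=\{\tau:[\tau,\xi]=0\ \forall\xi\}$. Assume that $\omega$ is non-degenerate, that $M+N=L$, and that $\theta(\eta,\cdot)$ vanishes on $M$ for all $\eta$. Let $q:L\to Q:=L/M$ be the quotient map; $[\xi,\cdot]$ is regarded as a linear form on $Q$. Let $\Omega:Q\times Q\to\mathbb{C}$ be an *admissible* form: symmetric and real bilinear, with positive definite real part, such that $(Q,\Re\Omega)$ is a separable Hilbert space, $\Im\Omega$ is continuous, and the continuous linear forms on $Q$ are exactly the maps $[\xi,\cdot]$, $\xi\in L$. ($L$ may have infinite dimension.) For a real Hilbert space $E$ let $\hat E\supseteq E$ be the algebraic dual of its topological dual $E^\star$, with the $\sigma$-algebra generated by the evaluations at the $\ell\in E^\star$.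 **Schrödinger representation.** Let $\nu_Q$ be the Gaussian measure on $\hat Q$ for which each $\ell\in Q^\star$ has law $N(0,\frac12\|\ell\|^2)$ (formally $\mathrm{d}\nu_Q=e^{-\Re\Omega(\phi,\phi)}\mathrm{d}\mu_Q$). For $\tau,\eta\in A$ and $v=\eta-\tau$ let $$\hat K^{\mathrm S,\eta}_\tau(\phi)=\exp\left(\mathrm{i}\theta(\tau,v)-\tfrac12\Omega(q(v),q(v))-\mathrm{i}[v,\phi]-\Omega(q(v),\phi)\right),$$ extended from $Q$ to $\hat Q$. The space $\mathcal{H}^{\tilde{\mathrm S}}$ consists of the families $(\psi^{\mathrm S,\eta})_{\eta\in A}$ in $\mathrm{L}^2(\hat Q,\nu_Q)$ that have representatives with $\psi^{\mathrm S,\eta'}(\phi)=\psi^{\mathrm S,\eta}(\phi+q(\eta'-\eta))\,\hat K^{\mathrm S,\eta'}_\eta(\phi)$ for all $\eta,\eta',\phi$; $\psi^{\mathrm S,\eta}$ is the $\eta$-reduced wave function of the state. **Holomorphic representation.** A *compatible complex structure* is a linear map $J:L\to L$ with $J^2=-\mathrm{id}$ and $\omega(J\cdot,J\cdot)=\omega$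 such that $g(\tau,\xi)=2\omega(\tau,J\xi)$ is positive definite and makes $L$ a separable Hilbert space in which $[\cdot,\cdot]$ is continuous. It *corresponds* to $\Omega$ if $\Omega(\phi,\phi')=g(j\phi,j\phi')-\mathrm{i}[j\phi,\phi']$, where $j:Q\to L$ is the linear section of $q$ with values in $JM$. Let $\{\tau,\xi\}=g(\tau,\xi)+2\mathrm{i}\omega(\tau,\xi)$, and let $\nu_L$ be the Gaussian measure on $\hat L$ for which each $\ell\in L^\star$ has law $N(0,\|\ell\|^2)$. Let $\mathrm{H}^2(\hat L,\nu_L)$ be the closure in $\mathrm{L}^2(\hat L,\nu_L)$ of the square-integrable holomorphic cylinder functions $x\mapsto p(\{\sigma_1,x\},\dots,\{\sigma_n,x\})$, with $p$ entire and $\sigma_i\in L$; its elements are restricted to $L$ by taking pointwise limits on $L$ of such functions converging in $\mathrm{L}^2$. For $\eta\in A$ let $$\alpha^\eta(\zeta)=\exp\left(\tfrac{\mathrm i}{2}\theta(\eta,\zeta-\eta)+\tfrac{\mathrm i}{2}\theta(\zeta,\zeta-\eta)-\tfrac14 g(\zeta-\eta,\zeta-\eta)\right),\qquad \zeta\in A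 .$$ The space $\mathcal{H}^{\hat{\mathrm H}}$ consists of the functions $\psi:A\to\mathbb{C}$ such that for every $\eta\in A$ one has $\psi(\zeta)=\psi^{\mathrm H,\eta}(\zeta-\eta)\,\alpha^\eta(\zeta)$ with $\psi^{\mathrm H,\eta}$ the restriction to $L$ of an element of $\mathrm{H}^2(\hat L,\nu_L)$. The holomorphic coherent state of $\tau\in A$ is $\hat K^{\hat{\mathrm H}}_\tau=\alpha^\tau$. **Theorem.** There is exactly one compatible complex structure $J$ corresponding to $\Omega$. For this $J$, passing to the $\eta$-reduced wave function identifies $\mathcal{H}^{\tilde{\mathrm S}}$ with $\mathrm{L}^2(\hat Q,\nu_Q)$, and $\psi\mapsto\psi^{\mathrm H,\eta}$ identifies $\mathcal{H}^{\hat{\mathrm H}}$ with $\mathrm{H}^2(\hat L,\nu_L)$; the resulting Hilbert space structures on $\mathcal{H}^{\tilde{\mathrm S}}$ and $\mathcal{H}^{\hat{\mathrm H}}$ do not depend on $\eta\in A$. There is an isometric isomorphism of Hilbert spaces $\hat{\mathcal B}:\mathcal{H}^{\tilde{\mathrm S}}\to\mathcal{H}^{\hat{\mathrm H}}$ such that for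 every $\tau\in A$ it maps the state whose $\eta$-reduced wave function is $\hat K^{\mathrm S,\eta}_\tau$, for every base point $\eta\in A$, to $\hat K^{\hat{\mathrm H}}_\tau$. -/

import Mathlib

open MeasureTheory ProbabilityTheory Filter Topology
open scoped NNReal ENNReal

noncomputable section

namespace AffineFieldTheory

/-! ### Inner products given by bilinear forms -/

/-- A symmetric positive definite real bilinear form. -/
structure InnerForm (V : Type*) [AddCommGroup V] [Module ℝ V] where
  form : V →ₗ[ℝ] V →ₗ[ℝ] ℝ
  symm : ∀ x y, form x y = form y x
  pos : ∀ x, x ≠ 0 → 0 < form x x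

namespace InnerForm

variable {V : Type*} [AddCommGroup V] [Module ℝ V]

@[reducible]
def core (b : InnerForm V) : InnerProductSpace.Core ℝ V where
  inner x y := b.form x y
  conj_inner_symm x y := by simp [b.symm y x]
  re_inner_nonneg x := by
    by_cases hx : x = 0
    · simp [hx]
    · exact (b.pos x hx).le
  add_left x y z := by simp
  smul_left x y r := by simp
  definite x hx := by
    by_contra h
    exact (b.pos x h).ne' hx

/-- The vector space `V` with the inner product `b`. -/
def Space (_b : InnerForm V) : Type _ := V

instance (b : InnerForm V) : NormedAddCommGroup b.Space :=
  @InnerProductSpace.Core.toNormedAddCommGroup ℝ V _ _ _ b.core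

instance (b : InnerForm V) : InnerProductSpace ℝ b.Space :=
  @InnerProductSpace.ofCore ℝ V _ _ _ b.core.toCore

/-- The identity map `V → (V, b)`. -/
def toSpace (b : InnerForm V) : V ≃ₗ[ℝ] b.Space where
  toFun x := x
  invFun x := x
  map_add' _ _ := rfl
  map_smul' _ _ := rfl
  left_inv _ := rfl
  right_inv _ := rfl

theorem inner_toSpace (b : InnerForm V) (x y : V) :
    inner ℝ (b.toSpace x) (b.toSpace y) = b.form x y := rfl

end InnerForm

/-! ### The extension of a Hilbert space carrying its Gaussian measures -/

section Gaussian

theorem integral_cexp_sum (ι : Type*) (s : Finset ι) (a : ι → ℝ) :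
    ∫ w, Complex.exp (Complex.I * ((∑ i ∈ s, a i * w i : ℝ) : ℂ))
      ∂(Measure.infinitePi fun _ : ι => gaussianReal 0 1) =
    Complex.exp (-((∑ i ∈ s, a i ^ 2 : ℝ) : ℂ) / 2) := by
  have hind : iIndepFun (fun (i : s) (w : ι → ℝ) => w i)
      (Measure.infinitePi fun _ : ι => gaussianReal 0 1) :=
    iIndepFun.precomp (g := fun i : s => (i : ι)) Subtype.val_injective
      (iIndepFun_infinitePi (X := fun _ w => w) (fun _ => measurable_id))
  have h1 := iIndepFun.integral_fun_prod_comp (𝕜 := ℂ) (ι := s) hind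
    (f := fun i x => Complex.exp (Complex.I * ((a i * x : ℝ) : ℂ)))
    (fun i => (measurable_pi_apply _).aemeasurable) (fun i => by
      apply Continuous.aestronglyMeasurable; fun_prop)
  have h2 : ∀ i : s, ∫ w : ι → ℝ, Complex.exp (Complex.I * ((a i * w i : ℝ) : ℂ))
      ∂(Measure.infinitePi fun _ : ι => gaussianReal 0 1)
      = Complex.exp (-((a i ^ 2 : ℝ) : ℂ) / 2) := by
    intro i
    have h3 := charFun_gaussianReal (μ := 0) (v := 1) (a i)
    rw [charFun_apply_real, ← Measure.infinitePi_map_eval (fun _ : ι => gaussianReal 0 1) (i : ι),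
      integral_map (measurable_pi_apply _).aemeasurable
        (by apply Continuous.aestronglyMeasurable; fun_prop)] at h3
    calc _ = ∫ w : ι → ℝ, Complex.exp (↑(a i) * ↑(w i) * Complex.I)
          ∂(Measure.infinitePi fun _ : ι => gaussianReal 0 1) := by
          congr 1; funext w; push_cast; ring_nf
      _ = _ := h3
      _ = _ := by push_cast; congr 1; simp; ring
  simp only [h2] at h1
  simp only [← Complex.exp_sum] at h1
  convert! h1 using 2
  · funext w
    congr 1
    rw [← Finset.mul_sum, ← Complex.ofReal_sum, Finset.sum_coe_sort s (fun i => a i * w i)]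
  · rw [← Finset.sum_div, Finset.sum_neg_distrib, ← Complex.ofReal_sum,
      Finset.sum_coe_sort s (fun i => a i ^ 2)]

theorem exists_isonormal (H : Type*) [NormedAddCommGroup H] [InnerProductSpace ℝ H]
    [CompleteSpace H] :
    ∃ (w : Set H) (P : Measure (w → ℝ)) (W : H →ₗᵢ[ℝ] Lp ℝ 2 P),
      ∀ h, P.map (W h) = gaussianReal 0 (‖h‖₊ ^ 2) := by
  obtain ⟨w, e, -⟩ := exists_hilbertBasis ℝ H
  set P : Measure (w → ℝ) := Measure.infinitePi fun _ : w => gaussianReal 0 1 with hP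
  have hmap : ∀ i : w, P.map (fun x : w → ℝ => x i) = gaussianReal 0 1 := fun i =>
    Measure.infinitePi_map_eval (fun _ : w => gaussianReal 0 1) i
  have hmem : ∀ i : w, MemLp (fun x : w → ℝ => x i) 2 P := fun i => by
    have := memLp_id_gaussianReal (μ := 0) (v := 1) 2
    rw [← hmap i] at this
    exact this.comp_of_map (measurable_pi_apply _).aemeasurable
  have h0 : ∀ i : w, ∫ x : w → ℝ, x i ∂P = 0 := fun i => by
    have := integral_id_gaussianReal (μ := 0) (v := 1)
    rwa [← hmap i, integral_map (measurable_pi_apply _).aemeasurable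
      (by apply Continuous.aestronglyMeasurable; fun_prop)] at this
  have hone : ∀ i : w, ∫ x : w → ℝ, x i * x i ∂P = 1 := fun i => by
    have h := variance_id_gaussianReal (μ := 0) (v := 1)
    rw [variance_eq_sub (memLp_id_gaussianReal 2)] at h
    simp only [integral_id_gaussianReal, id, Pi.pow_apply] at h
    rw [← hmap i, integral_map (measurable_pi_apply _).aemeasurable
      (by apply Continuous.aestronglyMeasurable; fun_prop)] at h
    simpa [sq] using h
  have horth : Orthonormal ℝ fun i : w => (hmem i).toLp := by
    classical
    rw [orthonormal_iff_ite]
    intro i j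
    rw [L2.inner_def]
    have : ∫ x, inner ℝ ((hmem i).toLp (fun x : w → ℝ => x i) x) ((hmem j).toLp _ x) ∂P
        = ∫ x : w → ℝ, x j * x i ∂P := by
      apply integral_congr_ae
      filter_upwards [(hmem i).coeFn_toLp, (hmem j).coeFn_toLp] with x h1 h2
      rw [h1, h2]; rfl
    rw [this]
    split_ifs with hij
    · subst hij; exact hone i
    · have hind : iIndepFun (fun (i : w) (x : w → ℝ) => x i) P :=
        iIndepFun_infinitePi (X := fun _ w => w) (fun _ => measurable_id)
      rw [(hind.indepFun (Ne.symm hij)).integral_fun_mul_eq_mul_integral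
        (measurable_pi_apply _).aestronglyMeasurable (measurable_pi_apply _).aestronglyMeasurable,
        h0 i, mul_zero]
  have hoF := horth.orthogonalFamily
  let W : H →ₗᵢ[ℝ] Lp ℝ 2 P := hoF.linearIsometry.comp e.repr.toLinearIsometry
  have hWe : ∀ i, W (e i) = (hmem i).toLp := by
    classical
    intro i
    change hoF.linearIsometry (e.repr (e i)) = _
    rw [e.repr_self, hoF.linearIsometry_apply_single]
    simp
  have hcont : Continuous fun h : H => ∫ x, Complex.exp (Complex.I * ((W h x : ℝ) : ℂ)) ∂P := by
    have hint : ∀ h, Integrable (fun x => Complex.exp (Complex.I * ((W h x : ℝ) : ℂ))) P := by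
      intro h
      refine Integrable.of_bound (C := 1) ?_ (ae_of_all _ fun x => ?_)
      · have := (Lp.aestronglyMeasurable (W h))
        have hc : Continuous fun y : ℝ => Complex.exp (Complex.I * (y : ℂ)) := by fun_prop
        exact hc.comp_aestronglyMeasurable this
      · rw [mul_comm, Complex.norm_exp_ofReal_mul_I]
    have : LipschitzWith 1 fun h : H =>
        ∫ x, Complex.exp (Complex.I * ((W h x : ℝ) : ℂ)) ∂P := by
      refine LipschitzWith.of_dist_le_mul fun h h' => ?_
      rw [dist_eq_norm, ← integral_sub (hint h) (hint h')]
      calc ‖∫ x, (Complex.exp (Complex.I * ((W h x : ℝ) : ℂ))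
              - Complex.exp (Complex.I * ((W h' x : ℝ) : ℂ))) ∂P‖
          ≤ ∫ x, ‖(W (h - h')) x‖ ∂P := by
            refine norm_integral_le_of_norm_le
              ((Lp.memLp (W (h - h'))).integrable (by norm_num)).norm ?_
            have := Lp.coeFn_sub (W h) (W h')
            rw [← map_sub] at this
            filter_upwards [this] with x hx
            rw [hx, Pi.sub_apply]
            have he : Complex.exp (Complex.I * ((W h x : ℝ) : ℂ))
              - Complex.exp (Complex.I * ((W h' x : ℝ) : ℂ))
              = Complex.exp (Complex.I * ((W h' x : ℝ) : ℂ)) *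
                (Complex.exp (Complex.I * ((W h x - W h' x : ℝ) : ℂ)) - 1) := by
              rw [mul_sub, ← Complex.exp_add]; push_cast; ring_nf
            rw [he, norm_mul, mul_comm Complex.I, Complex.norm_exp_ofReal_mul_I, one_mul]
            exact Real.norm_exp_I_mul_ofReal_sub_one_le
        _ ≤ ‖W (h - h')‖ := by
            have h1 := eLpNorm_le_eLpNorm_of_exponent_le (p := 1) (q := 2) (by norm_num)
              (Lp.aestronglyMeasurable (W (h - h')))
            rw [integral_norm_eq_lintegral_enorm (Lp.aestronglyMeasurable _),
              ← eLpNorm_one_eq_lintegral_enorm, Lp.norm_def]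
            exact ENNReal.toReal_mono (Lp.memLp _).2.ne h1
        _ = _ := by rw [W.norm_map, dist_eq_norm]; simp
    exact this.continuous
  have hchar : ∀ h : H, ∫ x, Complex.exp (Complex.I * ((W h x : ℝ) : ℂ)) ∂P
      = Complex.exp (-((‖h‖ ^ 2 : ℝ) : ℂ) / 2) := by
    intro h
    have hs := e.hasSum_repr h
    have hL := (hcont.tendsto h).comp hs
    have hR : Tendsto (fun s : Finset w =>
        Complex.exp (-((‖∑ i ∈ s, e.repr h i • e i‖ ^ 2 : ℝ) : ℂ) / 2)) atTop
        (𝓝 (Complex.exp (-((‖h‖ ^ 2 : ℝ) : ℂ) / 2))) := by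
      have hc : Continuous fun y : H => Complex.exp (-((‖y‖ ^ 2 : ℝ) : ℂ) / 2) := by fun_prop
      exact (hc.tendsto h).comp hs
    refine tendsto_nhds_unique hL (hR.congr fun s => ?_)
    have hn : ‖∑ i ∈ s, e.repr h i • e i‖ ^ 2 = ∑ i ∈ s, (e.repr h i) ^ 2 := by
      rw [← real_inner_self_eq_norm_sq, e.orthonormal.inner_sum]
      simp [sq]
    rw [hn, ← integral_cexp_sum]
    apply integral_congr_ae
    have hae : (W (∑ i ∈ s, e.repr h i • e i) : (w → ℝ) → ℝ) =ᵐ[P]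
        fun x => ∑ i ∈ s, e.repr h i * x i := by
      classical
      clear hn hR hL
      induction s using Finset.induction_on with
      | empty =>
        simp only [Finset.sum_empty, map_zero]
        exact Lp.coeFn_zero _ _ _
      | insert i s his ih =>
        simp only [Finset.sum_insert his, map_add, map_smul, hWe]
        filter_upwards [ih, Lp.coeFn_add (e.repr h i • (hmem i).toLp)
          (W (∑ i ∈ s, e.repr h i • e i)), Lp.coeFn_smul (e.repr h i) (hmem i).toLp,
          (hmem i).coeFn_toLp] with x h1 h2 h3 h4
        simp only [map_sum, map_smul, hWe] at h1 h2 ⊢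
        rw [h2, Pi.add_apply, h3, Pi.smul_apply, h4, h1, smul_eq_mul]
    filter_upwards [hae] with x hx
    simp only [hx]
  refine ⟨w, P, W, fun h => ?_⟩
  have hm : AEMeasurable (W h) P := (Lp.aestronglyMeasurable (W h)).aemeasurable
  have := Measure.isProbabilityMeasure_map hm
  refine Measure.ext_of_charFun ?_
  funext t
  rw [charFun_gaussianReal, charFun_apply_real,
    integral_map hm (by apply Continuous.aestronglyMeasurable; fun_prop)]
  have h1 := hchar (t • h)
  have h2 : ∫ x, Complex.exp (t * ((W h x : ℝ) : ℂ) * Complex.I) ∂P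
      = ∫ x, Complex.exp (Complex.I * ((W (t • h) x : ℝ) : ℂ)) ∂P := by
    apply integral_congr_ae
    have := Lp.coeFn_smul t (W h)
    rw [← map_smul] at this
    filter_upwards [this] with x hx
    rw [hx]; simp; ring_nf
  rw [h2, h1, norm_smul]
  congr 1
  push_cast
  simp only [mul_pow, Real.norm_eq_abs, ← Complex.ofReal_pow, sq_abs]
  push_cast
  ring

/-- The algebraic dual of the topological dual of `E`. -/
abbrev Extension (E : Type*) [NormedAddCommGroup E] [InnerProductSpace ℝ E] : Type _ :=
  Module.Dual ℝ (StrongDual ℝ E)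

variable {E : Type*} [NormedAddCommGroup E] [InnerProductSpace ℝ E]

/-- The cylinder σ-algebra: the smallest one for which all the evaluations `x ↦ x ℓ` are
measurable. -/
instance Extension.measurableSpace : MeasurableSpace (Extension E) :=
  MeasurableSpace.comap (fun (x : Extension E) (ℓ : StrongDual ℝ E) => x ℓ) MeasurableSpace.pi

/-- The canonical inclusion of `E` into its extension. -/
def Extension.incl (E : Type*) [NormedAddCommGroup E] [InnerProductSpace ℝ E] :
    E →ₗ[ℝ] Extension E where
  toFun φ :=
    { toFun := fun ℓ => ℓ φ
      map_add' := fun _ _ => rfl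
      map_smul' := fun _ _ => rfl }
  map_add' x y := by ext ℓ; simp
  map_smul' c x := by ext ℓ; simp

/-- `ν` is the centered Gaussian measure with variance `v` in each direction: every `ℓ` in the
topological dual has a normal law with variance `v ‖ℓ‖ ^ 2`. Equivalently, the image of `ν` in each
finite-dimensional quotient is proportional to `exp (- ‖x‖ ^ 2 / (2 v))` times Lebesgue measure. -/
def IsCanonicalGaussian (v : ℝ≥0) (ν : Measure (Extension E)) : Prop :=
  ∀ ℓ : StrongDual ℝ E, ν.map (fun x => x ℓ) = gaussianReal 0 (v * ‖ℓ‖₊ ^ 2)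

theorem measurable_extension_apply (ℓ : StrongDual ℝ E) :
    Measurable fun x : Extension E => x ℓ :=
  (measurable_pi_apply ℓ).comp (comap_measurable _)

theorem exists_isCanonicalGaussian [CompleteSpace E] (v : ℝ≥0) :
    ∃ ν : Measure (Extension E), IsCanonicalGaussian v ν := by
  obtain ⟨w, P, W, hW⟩ := exists_isonormal E
  let b := Module.Basis.ofVectorSpace ℝ (StrongDual ℝ E)
  let R : StrongDual ℝ E →ₗ[ℝ] Lp ℝ 2 P :=
    W.toLinearMap ∘ₗ (InnerProductSpace.toDual ℝ E).symm.toLinearEquiv.toLinearMap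
  let G : (w → ℝ) → Extension E := fun x => b.constr ℝ fun k => Real.sqrt v * R (b k) x
  have hG : ∀ x ℓ, G x ℓ = (b.repr ℓ).sum fun k c => c * (Real.sqrt v * R (b k) x) := by
    intro x ℓ
    simp only [G, b.constr_apply, smul_eq_mul]
  have hGm : Measurable G := by
    rw [measurable_comap_iff, measurable_pi_iff]
    intro ℓ
    simp only [Function.comp_def, hG, Finsupp.sum]
    exact Finset.measurable_fun_sum _ fun k _ => measurable_const.mul
      (measurable_const.mul (Lp.stronglyMeasurable (R (b k))).measurable)
  refine ⟨P.map G, fun ℓ => ?_⟩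
  rw [Measure.map_map (measurable_extension_apply ℓ) hGm]
  have hR : R ℓ = ∑ k ∈ (b.repr ℓ).support, (b.repr ℓ k) • R (b k) := by
    conv_lhs => rw [← b.linearCombination_repr ℓ]
    rw [Finsupp.linearCombination_apply, Finsupp.sum, map_sum]
    simp only [map_smul]
  have hsum : ∀ s : Finset _, ((∑ k ∈ s, (b.repr ℓ k) • R (b k) : Lp ℝ 2 P) : (w → ℝ) → ℝ)
      =ᵐ[P] fun x => ∑ k ∈ s, b.repr ℓ k * R (b k) x := by
    classical
    intro s
    induction s using Finset.induction_on with
    | empty => simpa using! Lp.coeFn_zero ℝ 2 P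
    | insert k s hk ih =>
      rw [Finset.sum_insert hk]
      filter_upwards [ih, Lp.coeFn_add (b.repr ℓ k • R (b k)) (∑ k ∈ s, (b.repr ℓ k) • R (b k)),
        Lp.coeFn_smul (b.repr ℓ k) (R (b k))] with x h1 h2 h3
      rw [h2, Pi.add_apply, h3, h1, Finset.sum_insert hk]
      rfl
  have hae : ((fun x : Extension E => x ℓ) ∘ G) =ᵐ[P] fun x => Real.sqrt v * R ℓ x := by
    filter_upwards [hsum (b.repr ℓ).support] with x hx
    rw [hR, hx, Function.comp_apply, hG, Finsupp.sum, Finset.mul_sum]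
    exact Finset.sum_congr rfl fun k _ => by ring
  have hRm : Measurable (R ℓ : (w → ℝ) → ℝ) := (Lp.stronglyMeasurable (R ℓ)).measurable
  rw [Measure.map_congr hae,
    ← Function.comp_def (fun y => Real.sqrt v * y) (R ℓ : (w → ℝ) → ℝ),
    ← Measure.map_map (measurable_const_mul _) hRm]
  have hlaw : P.map (R ℓ) = gaussianReal 0 (‖ℓ‖₊ ^ 2) := by
    have h := hW ((InnerProductSpace.toDual ℝ E).symm ℓ)
    rwa [LinearIsometryEquiv.nnnorm_map] at h
  rw [hlaw, gaussianReal_map_const_mul, mul_zero]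
  congr 2
  apply NNReal.eq
  simp

theorem IsCanonicalGaussian.isProbabilityMeasure {v : ℝ≥0} {ν : Measure (Extension E)}
    (h : IsCanonicalGaussian v ν) : IsProbabilityMeasure ν := by
  constructor
  have := congrArg (fun m => m Set.univ) (h 0)
  simpa [Measure.map_apply (measurable_extension_apply (0 : StrongDual ℝ E)) .univ] using this

theorem IsCanonicalGaussian.unique {v : ℝ≥0} {ν ν' : Measure (Extension E)}
    (h : IsCanonicalGaussian v ν) (h' : IsCanonicalGaussian v ν') : ν = ν' := by
  have := h.isProbabilityMeasure
  have := h'.isProbabilityMeasure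
  let i : Extension E → StrongDual ℝ E → ℝ := fun x ℓ => x ℓ
  have hi : Measurable i := comap_measurable _
  have key : ∀ I : Finset (StrongDual ℝ E),
      (ν.map i).map I.restrict = (ν'.map i).map I.restrict := by
    classical
    intro I
    have hI : Measurable (I.restrict : (StrongDual ℝ E → ℝ) → I → ℝ) := Finset.measurable_restrict I
    rw [Measure.map_map hI hi, Measure.map_map hI hi]
    have hm := hI.comp hi
    have := Measure.isProbabilityMeasure_map (μ := ν) hm.aemeasurable
    have := Measure.isProbabilityMeasure_map (μ := ν') hm.aemeasurable
    refine Measure.ext_of_charFunDual ?_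
    funext u
    rw [charFunDual_apply, charFunDual_apply,
      integral_map hm.aemeasurable (by apply Continuous.aestronglyMeasurable; fun_prop),
      integral_map hm.aemeasurable (by apply Continuous.aestronglyMeasurable; fun_prop)]
    let ℓ : StrongDual ℝ E := ∑ k : I, u (Pi.single k 1) • (k : StrongDual ℝ E)
    have hu : ∀ x : Extension E, u ((I.restrict ∘ i) x) = x ℓ := by
      intro x
      have hx := LinearMap.pi_apply_eq_sum_univ u.toLinearMap ((I.restrict ∘ i) x)
      have hd : ∀ k : I, (fun j : I => if k = j then (1 : ℝ) else 0) = Pi.single k 1 := by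
        intro k; ext j; simp [Pi.single_apply, eq_comm]
      simp only [hd] at hx
      refine hx.trans ?_
      simp only [ℓ, map_sum, map_smul, smul_eq_mul]
      exact Finset.sum_congr rfl fun k _ => mul_comm _ _
    simp only [hu]
    have hc : Continuous fun y : ℝ => Complex.exp ((y : ℂ) * Complex.I) := by fun_prop
    rw [← integral_map (f := fun y : ℝ => Complex.exp ((y : ℂ) * Complex.I))
        (measurable_extension_apply ℓ).aemeasurable hc.aestronglyMeasurable,
      ← integral_map (f := fun y : ℝ => Complex.exp ((y : ℂ) * Complex.I))
        (measurable_extension_apply ℓ).aemeasurable hc.aestronglyMeasurable, h ℓ, h' ℓ]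
  have := Measure.isProbabilityMeasure_map (μ := ν) hi.aemeasurable
  have := Measure.isProbabilityMeasure_map (μ := ν') hi.aemeasurable
  have hmap : ν.map i = ν'.map i := by
    refine IsProjectiveLimit.unique (P := fun I => (ν.map i).map I.restrict)
      (fun I => rfl) (fun I => (key I).symm)
  ext s hs
  obtain ⟨t, ht, rfl⟩ := hs
  have := congrArg (fun m => m t) hmap
  simpa only [Measure.map_apply hi ht] using this

/-- The centered Gaussian measure on the extension of the Hilbert space `E` with variance `v` in
each direction; see `exists_isCanonicalGaussian` and `IsCanonicalGaussian.unique`. -/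
def gaussian (E : Type*) [NormedAddCommGroup E] [InnerProductSpace ℝ E] (v : ℝ≥0) :
    Measure (Extension E) :=
  Classical.epsilon (IsCanonicalGaussian v)

theorem isCanonicalGaussian_gaussian [CompleteSpace E] (v : ℝ≥0) :
    IsCanonicalGaussian v (gaussian E v) :=
  Classical.epsilon_spec (exists_isCanonicalGaussian v)

end Gaussian

/-! ### Classical data -/

/-- The antisymmetrization `ω(ξ, ξ') = ([ξ, ξ'] - [ξ', ξ]) / 2`. -/
def symplecticForm {L : Type*} [AddCommGroup L] [Module ℝ L] (br : L →ₗ[ℝ] L →ₗ[ℝ] ℝ) :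
    L →ₗ[ℝ] L →ₗ[ℝ] ℝ :=
  (1 / 2 : ℝ) • (br - br.flip)

/-- An affine space `A` of solutions over `L` with its symplectic potential `θ`, equivariant with
respect to the bilinear form `[·,·]`. Here `LinearMap.ker bracket.flip` and `LinearMap.ker bracket`
are the subspaces `M = {τ : [ξ, τ] = 0 ∀ ξ}` and `N = {τ : [τ, ξ] = 0 ∀ ξ}`. -/
structure Theory (L A : Type*) [AddCommGroup L] [Module ℝ L] [AddTorsor L A] where
  θ : A → L →ₗ[ℝ] ℝ
  bracket : L →ₗ[ℝ] L →ₗ[ℝ] ℝ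
  equivariant : ∀ (η : A) (ξ τ : L), θ (ξ +ᵥ η) τ = θ η τ + bracket ξ τ
  nondegenerate : ∀ ξ, (∀ τ, symplecticForm bracket ξ τ = 0) → ξ = 0
  span : LinearMap.ker bracket.flip ⊔ LinearMap.ker bracket = ⊤
  /-- `θ` is adapted to the polarization `M`. -/
  adapted : ∀ (η : A), ∀ τ ∈ LinearMap.ker bracket.flip, θ η τ = 0

variable {L A : Type*} [AddCommGroup L] [Module ℝ L] [AddTorsor L A]

namespace Theory

variable (T : Theory L A)

/-- The symplectic form. -/
def ω : L →ₗ[ℝ] L →ₗ[ℝ] ℝ := symplecticForm T.bracket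

/-- The subspace defining the real (Schrödinger) polarization. -/
def M : Submodule ℝ L := LinearMap.ker T.bracket.flip

/-- The space `Q = L / M`. -/
abbrev Q : Type _ := L ⧸ T.M

/-- The quotient map `L → Q`. -/
def q : L →ₗ[ℝ] T.Q := T.M.mkQ

/-- `[ξ, ·]` as a linear form on `Q`. -/
def bracketQ (ξ : L) : T.Q →ₗ[ℝ] ℝ :=
  T.M.liftQ (T.bracket ξ) fun τ hτ => by
    have h : T.bracket.flip τ = 0 := hτ
    simpa using LinearMap.congr_fun h ξ

end Theory

/-! ### The Schrödinger representation -/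

/-- A symmetric bilinear form `Ω : Q × Q → ℂ` with positive definite real part. -/
structure VacuumForm (T : Theory L A) where
  form : T.Q →ₗ[ℝ] T.Q →ₗ[ℝ] ℂ
  symm : ∀ φ φ', form φ φ' = form φ' φ
  pos : ∀ φ, φ ≠ 0 → 0 < (form φ φ).re

namespace VacuumForm

variable {T : Theory L A} (Ω : VacuumForm T)

/-- The inner product on `Q` given by the real part of `Ω`. -/
def reForm : InnerForm T.Q where
  form := Ω.form.compr₂ Complex.reLm
  symm φ φ' := by simp [Ω.symm φ φ']
  pos φ h := by simpa using Ω.pos φ h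

/-- `Q` with the inner product given by the real part of `Ω`. -/
abbrev Space : Type _ := Ω.reForm.Space

def toSpace : T.Q ≃ₗ[ℝ] Ω.Space := Ω.reForm.toSpace

/-- The imaginary part of `Ω (φ, ·)`. -/
def imLeft (φ : T.Q) : Ω.Space →ₗ[ℝ] ℝ :=
  Complex.imLm ∘ₗ Ω.form φ ∘ₗ Ω.toSpace.symm.toLinearMap

/-- `[ξ, ·]` on `Q` with its inner product. -/
def bracketLeft (ξ : L) : Ω.Space →ₗ[ℝ] ℝ :=
  T.bracketQ ξ ∘ₗ Ω.toSpace.symm.toLinearMap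

/-- `Q` is a separable Hilbert space with respect to `Re Ω`, the imaginary part of `Ω` is continuous,
and the continuous linear forms on `Q` are exactly the maps `[ξ, ·]` for `ξ ∈ L`. -/
structure IsAdmissible : Prop where
  complete : CompleteSpace Ω.Space
  separable : TopologicalSpace.SeparableSpace Ω.Space
  continuous_im : Continuous fun p : Ω.Space × Ω.Space => Ω.imLeft (Ω.toSpace.symm p.1) p.2
  continuous_bracket : ∀ ξ : L, Continuous (Ω.bracketLeft ξ)
  exists_bracket : ∀ ℓ : StrongDual ℝ Ω.Space, ∃ ξ : L, ∀ φ, ℓ φ = Ω.bracketLeft ξ φ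

/-- The extension `Q̂` of `Q`. -/
abbrev QHat : Type _ := Extension Ω.Space

/-- The inclusion `Q → Q̂`. -/
def incl : T.Q →ₗ[ℝ] Ω.QHat := Extension.incl Ω.Space ∘ₗ Ω.toSpace.toLinearMap

/-- The Gaussian measure on `Q̂`, formally `exp (- Re Ω(φ, φ)) dμ(φ)`. -/
def νQ : Measure Ω.QHat := gaussian Ω.Space (1 / 2)

variable {Ω}

namespace IsAdmissible

variable (hΩ : Ω.IsAdmissible)

/-- `Im Ω(φ, ·)` as a continuous linear form. -/
def imDual (φ : T.Q) : StrongDual ℝ Ω.Space :=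
  ⟨Ω.imLeft φ, hΩ.continuous_im.comp (Continuous.prodMk_right (Ω.toSpace φ))⟩

/-- `[ξ, ·]` as a continuous linear form. -/
def bracketDual (ξ : L) : StrongDual ℝ Ω.Space :=
  ⟨Ω.bracketLeft ξ, hΩ.continuous_bracket ξ⟩

/-- The `η`-reduced Schrödinger wave function of the coherent state associated with `τ ∈ A`,
`φ ↦ exp (i θ(τ, v) - Ω(q v, q v) / 2 - i [v, φ] - Ω(q v, φ))` with `v = η - τ`, extended from `Q`
to `Q̂`. -/
def coherent (τ η : A) (φ : Ω.QHat) : ℂ :=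
  Complex.exp (Complex.I * (T.θ τ (η -ᵥ τ) : ℝ)
    - 1 / 2 * Ω.form (T.q (η -ᵥ τ)) (T.q (η -ᵥ τ))
    - Complex.I * (φ (hΩ.bracketDual (η -ᵥ τ)) : ℝ)
    - ((φ (innerSL ℝ (Ω.toSpace (T.q (η -ᵥ τ)))) : ℝ)
        + Complex.I * (φ (hΩ.imDual (T.q (η -ᵥ τ))) : ℝ)))

/-- On `Q` the function `coherent τ η` is the quotient `K τ (φ + c(η)) / K η (φ + c(η))` of the full
wave functions `K ζ (ζ') = exp (i θ(ζ, ζ' - ζ) - Ω(q(ζ' - ζ), q(ζ' - ζ)) / 2)`. -/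
theorem coherent_incl (τ η : A) (ξ : L) :
    hΩ.coherent τ η (Ω.incl (T.q ξ)) =
      Complex.exp (Complex.I * (T.θ τ ((ξ +ᵥ η) -ᵥ τ) : ℝ)
        - 1 / 2 * Ω.form (T.q ((ξ +ᵥ η) -ᵥ τ)) (T.q ((ξ +ᵥ η) -ᵥ τ))) /
      Complex.exp (Complex.I * (T.θ η ((ξ +ᵥ η) -ᵥ η) : ℝ)
        - 1 / 2 * Ω.form (T.q ((ξ +ᵥ η) -ᵥ η)) (T.q ((ξ +ᵥ η) -ᵥ η))) := by
  have h1 : T.θ η ξ = T.θ τ ξ + T.bracket (η -ᵥ τ) ξ := by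
    have := T.equivariant τ (η -ᵥ τ) ξ
    rwa [vsub_vadd] at this
  have h2 : Ω.incl (T.q ξ) (hΩ.bracketDual (η -ᵥ τ)) = T.bracket (η -ᵥ τ) ξ := rfl
  have h3 : Ω.incl (T.q ξ) (innerSL ℝ (Ω.toSpace (T.q (η -ᵥ τ))))
      = (Ω.form (T.q (η -ᵥ τ)) (T.q ξ)).re := rfl
  have h4 : Ω.incl (T.q ξ) (hΩ.imDual (T.q (η -ᵥ τ)))
      = (Ω.form (T.q (η -ᵥ τ)) (T.q ξ)).im := rfl
  have h5 : (((Ω.form (T.q (η -ᵥ τ)) (T.q ξ)).re : ℂ)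
      + Complex.I * (Ω.form (T.q (η -ᵥ τ)) (T.q ξ)).im) = Ω.form (T.q (η -ᵥ τ)) (T.q ξ) := by
    rw [mul_comm]; exact Complex.re_add_im _
  rw [coherent, ← Complex.exp_sub, h2, h3, h4, h5, vadd_vsub_assoc, vadd_vsub, map_add, map_add,
    map_add, h1]
  simp only [map_add, LinearMap.add_apply, Ω.symm (T.q ξ) (T.q (η -ᵥ τ))]
  congr 1
  push_cast
  ring

/-- The space of states of the Schrödinger representation. A state is a family of `η`-reduced wave
functions in `L²(Q̂, ν_Q)`, one for each base point `η`, with the transformation law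
`ψ^{η'}(φ) = ψ^{η}(φ + q(η' - η)) K^{η'}_η(φ)`. -/
def stateSpace : Submodule ℂ (A → Lp ℂ 2 Ω.νQ) where
  carrier := {Ψ | ∃ f : A → Ω.QHat → ℂ, (∀ η, Ψ η =ᵐ[Ω.νQ] f η) ∧
    ∀ η η' φ, f η' φ = f η (φ + Ω.incl (T.q (η' -ᵥ η))) * hΩ.coherent η η' φ}
  add_mem' := by
    rintro Ψ Φ ⟨f, hf, hf'⟩ ⟨g, hg, hg'⟩
    refine ⟨f + g, fun η => ?_, fun η η' φ => ?_⟩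
    · exact (Lp.coeFn_add _ _).trans ((hf η).add (hg η))
    · simp only [Pi.add_apply, hf' η η' φ, hg' η η' φ, add_mul]
  zero_mem' := ⟨0, fun η => Lp.coeFn_zero _ _ _, fun η η' φ => by simp⟩
  smul_mem' := by
    rintro c Ψ ⟨f, hf, hf'⟩
    refine ⟨c • f, fun η => ?_, fun η η' φ => ?_⟩
    · exact (Lp.coeFn_smul _ _).trans ((hf η).const_smul c)
    · simp only [Pi.smul_apply, hf' η η' φ, smul_eq_mul, mul_assoc]

end IsAdmissible

end VacuumForm

/-! ### The holomorphic representation -/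

/-- A complex structure on `L` that is compatible with the symplectic form and for which
`g(τ, ξ) = 2 ω(τ, J ξ)` is positive definite. -/
@[ext]
structure ComplexStructure (T : Theory L A) where
  J : L →ₗ[ℝ] L
  sq : ∀ ξ, J (J ξ) = -ξ
  symplectic : ∀ ξ τ, T.ω (J ξ) (J τ) = T.ω ξ τ
  pos : ∀ ξ, ξ ≠ 0 → 0 < T.ω ξ (J ξ)

namespace ComplexStructure

variable {T : Theory L A} (J : ComplexStructure T)

/-- The inner product `g(τ, ξ) = 2 ω(τ, J ξ)` on `L`. -/
def g : InnerForm L where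
  form := (2 : ℝ) • T.ω.compl₂ J.J
  symm x y := by
    have h : T.ω x (J.J y) = T.ω y (J.J x) := by
      rw [← J.symplectic x (J.J y), J.sq]
      simp [Theory.ω, symplecticForm]
      ring
    simp [h]
  pos x hx := by simpa using J.pos x hx

/-- `L` with the inner product `g`. -/
abbrev Space : Type _ := J.g.Space

def toSpace : L ≃ₗ[ℝ] J.Space := J.g.toSpace

/-- `g` makes `L` a separable Hilbert space for which `[·,·]` is continuous. -/
structure IsAdmissible : Prop where
  complete : CompleteSpace J.Space
  separable : TopologicalSpace.SeparableSpace J.Space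
  continuous_bracket : Continuous fun p : J.Space × J.Space =>
    T.bracket (J.toSpace.symm p.1) (J.toSpace.symm p.2)

/-- `J` and `Ω` correspond to each other: `Ω(φ, φ') = g(j φ, j φ') - i [j φ, φ']`, where
`j : Q → L` is the linear section of the quotient map with values in `J M`. -/
def Corresponds (Ω : VacuumForm T) : Prop :=
  ∃ j : T.Q →ₗ[ℝ] L, (∀ φ, T.q (j φ) = φ) ∧ (∀ φ, j φ ∈ T.M.map J.J) ∧
    ∀ φ φ', Ω.form φ φ' = (J.g.form (j φ) (j φ') : ℝ) - Complex.I * (T.bracketQ (j φ) φ' : ℝ)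

/-- The extension `L̂` of `L`. -/
abbrev LHat : Type _ := Extension J.Space

/-- The inclusion `L → L̂`. -/
def incl : L →ₗ[ℝ] J.LHat := Extension.incl J.Space ∘ₗ J.toSpace.toLinearMap

/-- The Gaussian measure on `L̂`, formally `exp (- g(ξ, ξ) / 2) dμ(ξ)`. -/
def νL : Measure J.LHat := gaussian J.Space 1

/-- The extension to `L̂` of the complex linear form `{σ, ·} = g(σ, ·) + 2 i ω(σ, ·)` on `(L, J)`.
Note that `2 ω(σ, ·) = g(J σ, ·)`. -/
def coord (σ : L) (x : J.LHat) : ℂ :=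
  (x (innerSL ℝ (J.toSpace σ)) : ℝ) + Complex.I * (x (innerSL ℝ (J.toSpace (J.J σ))) : ℝ)

theorem coord_incl (σ ξ : L) :
    J.coord σ (J.incl ξ) = (J.g.form σ ξ : ℝ) + 2 * Complex.I * (T.ω σ ξ : ℝ) := by
  have h1 : J.incl ξ (innerSL ℝ (J.toSpace σ)) = J.g.form σ ξ := rfl
  have h2 : J.incl ξ (innerSL ℝ (J.toSpace (J.J σ))) = 2 * T.ω (J.J σ) (J.J ξ) := rfl
  rw [coord, h1, h2, J.symplectic]
  push_cast
  ring

/-- Holomorphic cylinder functions on `L̂`: entire functions of finitely many continuous complex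
linear coordinates. -/
def IsHolCylinder (f : J.LHat → ℂ) : Prop :=
  ∃ (n : ℕ) (σ : Fin n → L) (p : (Fin n → ℂ) → ℂ), Differentiable ℂ p ∧
    ∀ x, f x = p fun i => J.coord (σ i) x

theorem IsHolCylinder.add {f f' : J.LHat → ℂ} (h : J.IsHolCylinder f) (h' : J.IsHolCylinder f') :
    J.IsHolCylinder (f + f') := by
  obtain ⟨n, σ, p, hp, hf⟩ := h
  obtain ⟨n', σ', p', hp', hf'⟩ := h'
  refine ⟨n + n', Fin.append σ σ',
    fun z => p (fun i => z (Fin.castAdd n' i)) + p' (fun i => z (Fin.natAdd n i)), ?_, fun x => ?_⟩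
  · exact (hp.comp (by fun_prop)).add (hp'.comp (by fun_prop))
  · simp [hf, hf']

theorem IsHolCylinder.smul {f : J.LHat → ℂ} (c : ℂ) (h : J.IsHolCylinder f) :
    J.IsHolCylinder (c • f) := by
  obtain ⟨n, σ, p, hp, hf⟩ := h
  exact ⟨n, σ, fun z => c * p z, by fun_prop, fun x => by simp [hf]⟩

/-- The Hilbert space `H²(L̂, ν_L)` of holomorphic square-integrable functions: the closure in
`L²(L̂, ν_L)` of the square-integrable holomorphic cylinder functions. -/
def H2 : Submodule ℂ (Lp ℂ 2 J.νL) :=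
  (Submodule.span ℂ {F : Lp ℂ 2 J.νL | ∃ f, J.IsHolCylinder f ∧ F =ᵐ[J.νL] f}).topologicalClosure

/-- `h` is the restriction to `L` of the holomorphic function `F` on `L̂`. (`L` may be a null set.
For a holomorphic cylinder function this is the ordinary restriction, and it extends to limits
in `L²` by pointwise convergence on `L`.) -/
def IsRestriction (F : Lp ℂ 2 J.νL) (h : L → ℂ) : Prop :=
  ∃ f : ℕ → J.LHat → ℂ, (∀ k, J.IsHolCylinder (f k)) ∧ (∀ k, MemLp (f k) 2 J.νL) ∧
    Tendsto (fun k => eLpNorm (f k - ⇑F) 2 J.νL) atTop (𝓝 0) ∧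
    ∀ ξ, Tendsto (fun k => f k (J.incl ξ)) atTop (𝓝 (h ξ))

/-- The function `α^η` on `A`. -/
def α (η ζ : A) : ℂ :=
  Complex.exp (Complex.I / 2 * (T.θ η (ζ -ᵥ η) : ℝ) + Complex.I / 2 * (T.θ ζ (ζ -ᵥ η) : ℝ)
    - 1 / 4 * (J.g.form (ζ -ᵥ η) (ζ -ᵥ η) : ℝ))

/-- The wave function on `A` of the holomorphic coherent state associated with `τ ∈ A`. -/
def coherent (τ : A) : A → ℂ := fun ζ =>
  Complex.exp (Complex.I / 2 * (T.θ τ (ζ -ᵥ τ) : ℝ) + Complex.I / 2 * (T.θ ζ (ζ -ᵥ τ) : ℝ)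
    - 1 / 4 * (J.g.form (ζ -ᵥ τ) (ζ -ᵥ τ) : ℝ))

/-- `F` represents the wave function `ψ` with respect to the base point `η`:
`ψ(ζ) = F(ζ - η) α^η(ζ)` for all `ζ ∈ A`. -/
def Represents (η : A) (ψ : A → ℂ) (F : Lp ℂ 2 J.νL) : Prop :=
  ∃ h : L → ℂ, J.IsRestriction F h ∧ ∀ ζ, ψ ζ = h (ζ -ᵥ η) * J.α η ζ

theorem Represents.add {η : A} {ψ ψ' : A → ℂ} {F F' : Lp ℂ 2 J.νL} (h : J.Represents η ψ F)
    (h' : J.Represents η ψ' F') : J.Represents η (ψ + ψ') (F + F') := by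
  obtain ⟨r, ⟨f, h1, h2, h3, h4⟩, hr⟩ := h
  obtain ⟨r', ⟨f', h1', h2', h3', h4'⟩, hr'⟩ := h'
  refine ⟨r + r', ⟨fun k => f k + f' k, fun k => (h1 k).add J (h1' k), fun k => (h2 k).add (h2' k),
    ?_, fun ξ => (h4 ξ).add (h4' ξ)⟩, fun ζ => by simp [hr, hr', add_mul]⟩
  refine tendsto_of_tendsto_of_tendsto_of_le_of_le tendsto_const_nhds
    (by simpa using h3.add h3') (fun _ => zero_le) fun k => ?_
  have : (f k + f' k - ⇑(F + F') : J.LHat → ℂ) =ᵐ[J.νL] (f k - ⇑F) + (f' k - ⇑F') := by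
    filter_upwards [Lp.coeFn_add F F'] with x hx
    simp only [Pi.sub_apply, Pi.add_apply, hx]
    ring
  rw [eLpNorm_congr_ae this]
  exact eLpNorm_add_le ((h2 k).1.sub (Lp.aestronglyMeasurable F))
    ((h2' k).1.sub (Lp.aestronglyMeasurable F')) (by norm_num)

theorem Represents.smul {η : A} {ψ : A → ℂ} {F : Lp ℂ 2 J.νL} (c : ℂ) (h : J.Represents η ψ F) :
    J.Represents η (c • ψ) (c • F) := by
  obtain ⟨r, ⟨f, h1, h2, h3, h4⟩, hr⟩ := h
  refine ⟨c • r, ⟨fun k => c • f k, fun k => (h1 k).smul J c, fun k => (h2 k).const_smul c,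
    ?_, fun ξ => (h4 ξ).const_smul c⟩, fun ζ => by simp [hr, mul_assoc]⟩
  have hc := ENNReal.Tendsto.const_mul (a := ‖c‖ₑ) h3 (Or.inr (by simp))
  rw [mul_zero] at hc
  refine hc.congr fun k => ?_
  have : (c • f k - ⇑(c • F) : J.LHat → ℂ) =ᵐ[J.νL] c • (f k - ⇑F) := by
    filter_upwards [Lp.coeFn_smul c F] with x hx
    simp only [Pi.sub_apply, Pi.smul_apply, hx, smul_sub]
  rw [eLpNorm_congr_ae this, eLpNorm_const_smul]

theorem represents_zero (η : A) : J.Represents η 0 0 := by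
  refine ⟨0, ⟨fun _ => 0, fun _ => ⟨0, Fin.elim0, 0, by fun_prop, fun _ => rfl⟩, fun _ => .zero,
    ?_, fun _ => tendsto_const_nhds⟩, fun _ => by simp⟩
  have : (0 - ⇑(0 : Lp ℂ 2 J.νL) : J.LHat → ℂ) =ᵐ[J.νL] 0 := by
    filter_upwards [Lp.coeFn_zero ℂ 2 J.νL] with x hx
    rw [Pi.sub_apply, hx]; simp
  simp only [eLpNorm_congr_ae this, eLpNorm_zero]
  exact tendsto_const_nhds

/-- The space of states of the holomorphic representation. It consists of the functions `ψ` on `A`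
such that for each base point `η` the function `ψ / α^η`, viewed as a function on `L`, is the
restriction to `L` of a holomorphic square-integrable function on `L̂`. -/
def stateSpace : Submodule ℂ (A → ℂ) where
  carrier := {ψ | ∀ η, ∃ F ∈ J.H2, J.Represents η ψ F}
  add_mem' h h' η := by
    obtain ⟨F, hF, hψ⟩ := h η
    obtain ⟨F', hF', hψ'⟩ := h' η
    exact ⟨F + F', add_mem hF hF', hψ.add J hψ'⟩
  zero_mem' η := ⟨0, zero_mem _, J.represents_zero η⟩
  smul_mem' c ψ h η := by
    obtain ⟨F, hF, hψ⟩ := h η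
    exact ⟨c • F, J.H2.smul_mem c hF, hψ.smul J c⟩

end ComplexStructure

end AffineFieldTheory

end

open AffineFieldTheory

/-! Both representations contain coherent states indexed by `A`, and the isomorphism is the one that
matches them. Two total families with the same Gram matrix are related by a unitary map
(`exists_linearIsometryEquiv_of_inner_eq`), so the analytic content is totality of both families and
the fact that both Gram matrices equal `J.coherent ζ' ζ`.

Complex structure: `Re Ω` turns the form `[ξ, ·] + Im Ω(q ξ, ·)` into a vector `p ξ` of `Q`. The
pair `(p, q)` identifies `L` with `Q × Q`, with `ω` half the canonical form; `J` is `(p, q) ↦ (-q,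
p)` and `g` is the orthogonal sum of two copies of `Re Ω`. Correspondence to `Ω` forces these
formulas (`p_q_of_corresponds`).

Schrödinger side: the squared modulus of the cocycle is the density of a translated Gaussian
measure, so changing the base point is unitary. A Gram entry, computed at the base point where one
factor is 1, is a Gaussian integral of the exponential of a complex linear form
(`IsCanonicalGaussian.integral_cexp`). Totality is injectivity of the Fourier transform: momentum
translates of the vacuum are characters.

Holomorphic side: invariance of `ν_L` under `exp (t J)` gives the mean value property. Translation
then shows that `exp ({ξ, ·} / 2)` reproduces the value at `ξ`. Hence restriction to `L` is given by
inner products with these exponentials, which are total in `H²`.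

A state `F` thus has the holomorphic wave function `ζ ↦ ⟨K_ζ, F⟩`. This formula involves no base
point, which is why the Hilbert space structure involves none either. -/

noncomputable section

namespace AffineFieldTheory

/-! ### Fourier transform, exponential integrals and translations for Gaussian measures on the
extension. -/

section GaussianCalculus

variable {E : Type*} [NormedAddCommGroup E] [InnerProductSpace ℝ E]

@[fun_prop]
theorem Extension.measurable_apply (ℓ : StrongDual ℝ E) : Measurable fun x : Extension E => x ℓ :=
  measurable_extension_apply ℓ

/-- A finite measure on the extension of `E` is determined by its characteristic functional. -/
theorem Extension.ext_of_integral_cexp {μ μ' : Measure (Extension E)} [IsFiniteMeasure μ]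
    [IsFiniteMeasure μ'] (h : ∀ ℓ : StrongDual ℝ E,
      ∫ x, Complex.exp ((x ℓ : ℝ) * Complex.I) ∂μ = ∫ x, Complex.exp ((x ℓ : ℝ) * Complex.I) ∂μ') :
    μ = μ' := by
  let i : Extension E → StrongDual ℝ E → ℝ := fun x ℓ => x ℓ
  have hi : Measurable i := comap_measurable _
  have key : ∀ I : Finset (StrongDual ℝ E),
      (μ.map i).map I.restrict = (μ'.map i).map I.restrict := by
    classical
    intro I
    have hI : Measurable (I.restrict : (StrongDual ℝ E → ℝ) → I → ℝ) := Finset.measurable_restrict I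
    rw [Measure.map_map hI hi, Measure.map_map hI hi]
    have hm := hI.comp hi
    refine Measure.ext_of_charFunDual ?_
    funext u
    rw [charFunDual_apply, charFunDual_apply,
      integral_map hm.aemeasurable (by apply Continuous.aestronglyMeasurable; fun_prop),
      integral_map hm.aemeasurable (by apply Continuous.aestronglyMeasurable; fun_prop)]
    -- Since `x` is linear, a linear form in finitely many evaluations is itself one evaluation; the
    -- characteristic functional therefore determines every finite-dimensional marginal.
    let ℓ : StrongDual ℝ E := ∑ k : I, u (Pi.single k 1) • (k : StrongDual ℝ E)
    have hu : ∀ x : Extension E, u ((I.restrict ∘ i) x) = x ℓ := by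
      intro x
      have hx := LinearMap.pi_apply_eq_sum_univ u.toLinearMap ((I.restrict ∘ i) x)
      have hd : ∀ k : I, (fun j : I => if k = j then (1 : ℝ) else 0) = Pi.single k 1 := by
        intro k; ext j; simp [Pi.single_apply, eq_comm]
      simp only [hd] at hx
      refine hx.trans ?_
      simp only [ℓ, map_sum, map_smul, smul_eq_mul]
      exact Finset.sum_congr rfl fun k _ => mul_comm _ _
    simp only [hu]
    exact h ℓ
  have hmap : μ.map i = μ'.map i := by
    refine IsProjectiveLimit.unique (P := fun I => (μ.map i).map I.restrict)
      (fun I => rfl) (fun I => (key I).symm)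
  ext s hs
  obtain ⟨t, ht, rfl⟩ := hs
  have := congrArg (fun m => m t) hmap
  simpa only [Measure.map_apply hi ht] using this

theorem Extension.measurable_of_apply {α : Type*} [MeasurableSpace α] {f : α → Extension E}
    (h : ∀ ℓ : StrongDual ℝ E, Measurable fun a => f a ℓ) : Measurable f := by
  rw [measurable_comap_iff, measurable_pi_iff]
  exact h

theorem Extension.measurable_add_const (y : Extension E) :
    Measurable fun x : Extension E => x + y :=
  Extension.measurable_of_apply fun ℓ => by
    simp only [LinearMap.add_apply]
    fun_prop

/-- The positive and negative parts of `f` are densities of two finite measures with the same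
characteristic functional, so these measures, and then the two parts, coincide. -/
theorem ae_eq_zero_of_integral_cexp_mul_real {ν : Measure (Extension E)}
    {f : Extension E → ℝ} (hf : Integrable f ν)
    (h : ∀ ℓ : StrongDual ℝ E, ∫ x, Complex.exp ((x ℓ : ℝ) * Complex.I) * (f x : ℂ) ∂ν = 0) :
    f =ᵐ[ν] 0 := by
  have hbd : ∀ ℓ : StrongDual ℝ E, ∀ x : Extension E,
      ‖Complex.exp ((x ℓ : ℝ) * Complex.I)‖ ≤ 1 := fun ℓ x => by
    rw [Complex.norm_exp_ofReal_mul_I]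
  have hms : ∀ ℓ : StrongDual ℝ E, Measurable fun x : Extension E =>
      Complex.exp ((x ℓ : ℝ) * Complex.I) := fun ℓ => by fun_prop
  have hi : ∀ (ℓ : StrongDual ℝ E) (u : Extension E → ℝ), Integrable u ν →
      Integrable (fun x => Complex.exp ((x ℓ : ℝ) * Complex.I) * (u x : ℂ)) ν := fun ℓ u hu =>
    hu.ofReal.bdd_mul (hms ℓ).aestronglyMeasurable (ae_of_all _ (hbd ℓ))
  have hp : Integrable (fun x => max (f x) 0) ν := hf.pos_part
  have hn : Integrable (fun x => max (-f x) 0) ν := hf.neg_part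
  have := isFiniteMeasure_withDensity_ofReal hf.2
  have := isFiniteMeasure_withDensity_ofReal hf.neg.2
  have hd : ∀ (u : Extension E → ℝ), AEMeasurable u ν → ∀ ℓ : StrongDual ℝ E,
      ∫ x, Complex.exp ((x ℓ : ℝ) * Complex.I) ∂(ν.withDensity fun x => ENNReal.ofReal (u x))
      = ∫ x, Complex.exp ((x ℓ : ℝ) * Complex.I) * ((max (u x) 0 : ℝ) : ℂ) ∂ν := by
    intro u hu ℓ
    rw [integral_withDensity_eq_integral_toReal_smul₀ hu.ennreal_ofReal
      (ae_of_all _ fun _ => ENNReal.ofReal_lt_top)]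
    refine integral_congr_ae (ae_of_all _ fun x => ?_)
    simp only [ENNReal.toReal_ofReal', Complex.real_smul]
    ring
  have heq : (ν.withDensity fun x => ENNReal.ofReal (f x))
      = ν.withDensity fun x => ENNReal.ofReal ((-f) x) := by
    refine Extension.ext_of_integral_cexp fun ℓ => ?_
    rw [hd f hf.aemeasurable, hd (-f) hf.neg.aemeasurable, ← sub_eq_zero,
      ← h ℓ]
    refine (integral_sub (hi ℓ _ hp) (hi ℓ _ hn)).symm.trans ?_
    refine integral_congr_ae (ae_of_all _ fun x => ?_)
    have : f x = max (f x) 0 - max (-f x) 0 := by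
      rcases le_total (f x) 0 with h | h <;> simp [h]
    simp only
    rw [← mul_sub, ← Complex.ofReal_sub, ← this]
  have := (withDensity_eq_iff hf.aemeasurable.ennreal_ofReal hf.neg.aemeasurable.ennreal_ofReal
    hf.lintegral_lt_top.ne).1 heq
  filter_upwards [this] with x hx
  have := congrArg ENNReal.toReal hx
  simp only [ENNReal.toReal_ofReal', Pi.neg_apply] at this
  rcases le_total (f x) 0 with h | h
  · have h2 : 0 ≤ -f x := by linarith
    rw [max_eq_right h, max_eq_left h2] at this
    simp; linarith
  · have h2 : -f x ≤ 0 := by linarith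
    rw [max_eq_left h, max_eq_right h2] at this
    exact this

/-- An integrable function all of whose Fourier coefficients vanish is zero. -/
theorem ae_eq_zero_of_integral_cexp_mul {ν : Measure (Extension E)}
    {F : Extension E → ℂ} (hF : Integrable F ν)
    (h : ∀ ℓ : StrongDual ℝ E, ∫ x, Complex.exp ((x ℓ : ℝ) * Complex.I) * F x ∂ν = 0) :
    F =ᵐ[ν] 0 := by
  have hbd : ∀ ℓ : StrongDual ℝ E, ∀ x : Extension E,
      ‖Complex.exp ((x ℓ : ℝ) * Complex.I)‖ ≤ 1 := fun ℓ x => by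
    rw [Complex.norm_exp_ofReal_mul_I]
  have hms : ∀ ℓ : StrongDual ℝ E, Measurable fun x : Extension E =>
      Complex.exp ((x ℓ : ℝ) * Complex.I) := fun ℓ => by fun_prop
  have hi : ∀ (ℓ : StrongDual ℝ E) (u : Extension E → ℂ), Integrable u ν →
      Integrable (fun x => Complex.exp ((x ℓ : ℝ) * Complex.I) * u x) ν := fun ℓ u hu =>
    hu.bdd_mul (hms ℓ).aestronglyMeasurable (ae_of_all _ (hbd ℓ))
  have hFc : Integrable (fun x => (starRingEnd ℂ) (F x)) ν :=
    (Complex.conjCLE.toContinuousLinearMap).integrable_comp hF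
  have hc : ∀ ℓ : StrongDual ℝ E,
      ∫ x, Complex.exp ((x ℓ : ℝ) * Complex.I) * (starRingEnd ℂ) (F x) ∂ν = 0 := by
    intro ℓ
    -- Conjugation turns the coefficient of `F` at `-ℓ` into that of its conjugate at `ℓ`; this
    -- allows real and imaginary parts to be treated separately.
    have := congrArg (starRingEnd ℂ) (h (-ℓ))
    rw [← integral_conj, map_zero] at this
    rw [← this]
    refine integral_congr_ae (ae_of_all _ fun x => ?_)
    simp [← Complex.exp_conj]
  have hre : (fun x => (F x).re) =ᵐ[ν] 0 := by
    refine ae_eq_zero_of_integral_cexp_mul_real hF.re fun ℓ => ?_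
    calc _ = ∫ x, (1 / 2 : ℂ) * (Complex.exp ((x ℓ : ℝ) * Complex.I) * F x
          + Complex.exp ((x ℓ : ℝ) * Complex.I) * (starRingEnd ℂ) (F x)) ∂ν := by
          refine integral_congr_ae (ae_of_all _ fun x => ?_)
          simp only [Complex.re_eq_add_conj]
          ring
      _ = 0 := by
          rw [integral_const_mul, integral_add (hi ℓ _ hF) (hi ℓ _ hFc), h, hc]
          simp
  have him : (fun x => (F x).im) =ᵐ[ν] 0 := by
    refine ae_eq_zero_of_integral_cexp_mul_real hF.im fun ℓ => ?_
    calc _ = ∫ x, (1 / (2 * Complex.I)) * (Complex.exp ((x ℓ : ℝ) * Complex.I) * F x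
          - Complex.exp ((x ℓ : ℝ) * Complex.I) * (starRingEnd ℂ) (F x)) ∂ν := by
          refine integral_congr_ae (ae_of_all _ fun x => ?_)
          simp only [Complex.im_eq_sub_conj]
          ring
      _ = 0 := by
          rw [integral_const_mul, integral_sub (hi ℓ _ hF) (hi ℓ _ hFc), h, hc]
          simp
  filter_upwards [hre, him] with x h1 h2
  exact Complex.ext h1 h2

namespace IsCanonicalGaussian

variable {v : ℝ≥0} {ν : Measure (Extension E)}

theorem integrable_exp (hν : IsCanonicalGaussian v ν) (ℓ : StrongDual ℝ E) :
    Integrable (fun x => Real.exp (x ℓ)) ν := by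
  have := integrable_exp_mul_gaussianReal (μ := 0) (v := v * ‖ℓ‖₊ ^ 2) 1
  rw [← hν ℓ] at this
  simpa [Function.comp_def] using this.comp_measurable (measurable_extension_apply ℓ)

theorem integral_cexp_mul (hν : IsCanonicalGaussian v ν) (ℓ : StrongDual ℝ E) (z : ℂ) :
    ∫ x, Complex.exp (z * (x ℓ : ℝ)) ∂ν = Complex.exp ((v : ℂ) / 2 * (‖ℓ‖ : ℂ) ^ 2 * z ^ 2) := by
  have := complexMGF_gaussianReal (hν ℓ) z
  rw [complexMGF] at this
  rw [this]
  congr 1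
  push_cast
  ring

/-- The joint characteristic function is the exponential of a quadratic form whose cross term is a
multiple of `⟨a, b⟩`, so it factors. -/
theorem indepFun (hν : IsCanonicalGaussian v ν) {a b : E} (hab : inner ℝ a b = 0) :
    IndepFun (fun x : Extension E => x (innerSL ℝ a)) (fun x => x (innerSL ℝ b)) ν := by
  have := hν.isProbabilityMeasure
  have hchar : ∀ c : E, ∫ x : Extension E, Complex.exp ((x (innerSL ℝ c) : ℝ) * Complex.I) ∂ν
      = Complex.exp (-((v : ℂ) / 2 * (inner ℝ c c : ℝ))) := fun c => by
    have := hν.integral_cexp_mul (innerSL ℝ c) Complex.I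
    simp only [mul_comm Complex.I] at this
    rw [this, innerSL_apply_norm, real_inner_self_eq_norm_sq]
    push_cast
    simp
  have hm : ∀ c : E, AEMeasurable (fun x : Extension E => x (innerSL ℝ c)) ν := fun c =>
    (measurable_extension_apply _).aemeasurable
  rw [indepFun_iff_charFunDual_prod (hm a) (hm b)]
  intro u
  rw [charFunDual_apply, charFunDual_apply, charFunDual_apply, integral_map ((hm a).prodMk (hm b))
    (by apply Continuous.aestronglyMeasurable; fun_prop), integral_map (hm a)
    (by apply Continuous.aestronglyMeasurable; fun_prop), integral_map (hm b)
    (by apply Continuous.aestronglyMeasurable; fun_prop)]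
  have hs : ∀ s t : ℝ, u (s, t) = s * u (1, 0) + t * u (0, 1) := fun s t => by
    have : (s, t) = s • ((1 : ℝ), (0 : ℝ)) + t • ((0 : ℝ), (1 : ℝ)) := by ext <;> simp
    rw [this, map_add, map_smul, map_smul, smul_eq_mul, smul_eq_mul]
  have h1 : ∀ x : Extension E, u (x (innerSL ℝ a), x (innerSL ℝ b))
      = x (innerSL ℝ (u (1, 0) • a + u (0, 1) • b)) := fun x => by
    rw [hs]; simp [mul_comm]
  have h2 : ∀ x : Extension E, (u.comp (.inl ℝ ℝ ℝ)) (x (innerSL ℝ a))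
      = x (innerSL ℝ (u (1, 0) • a)) := fun x => by
    simp only [ContinuousLinearMap.comp_apply, ContinuousLinearMap.inl_apply]
    rw [hs]; simp [mul_comm]
  have h3 : ∀ x : Extension E, (u.comp (.inr ℝ ℝ ℝ)) (x (innerSL ℝ b))
      = x (innerSL ℝ (u (0, 1) • b)) := fun x => by
    simp only [ContinuousLinearMap.comp_apply, ContinuousLinearMap.inr_apply]
    rw [hs]; simp [mul_comm]
  simp only [h1, h2, h3, hchar]
  rw [← Complex.exp_add]
  congr 1
  simp only [inner_add_left, inner_add_right, inner_smul_left, inner_smul_right, hab,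
    real_inner_comm a b]
  push_cast
  simp
  ring

/-- The Gaussian integral of the exponential of a complex linear function. -/
theorem integral_cexp (hν : IsCanonicalGaussian v ν) (a b : E) :
    ∫ x, Complex.exp ((x (innerSL ℝ a) : ℝ) + Complex.I * (x (innerSL ℝ b) : ℝ)) ∂ν =
      Complex.exp ((v : ℂ) / 2 * ((inner ℝ a a : ℝ) - (inner ℝ b b : ℝ)
        + 2 * Complex.I * (inner ℝ a b : ℝ))) := by
  -- Splitting `b` into a multiple of `a` and a part orthogonal to `a` yields independent variables.
  -- For `a = 0` the convention `c = 0` is harmless, since both sides of `hca` vanish.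
  set c : ℝ := inner ℝ a b / inner ℝ a a with hc
  have hca : c * inner ℝ a a = inner ℝ a b := by
    by_cases ha : a = 0
    · simp [ha]
    · rw [hc, div_mul_cancel₀]; exact inner_self_ne_zero.2 ha
  set b' : E := b - c • a with hb'
  have hab : inner ℝ a b' = 0 := by
    rw [hb', inner_sub_right, inner_smul_right, hca, sub_self]
  have hi := hν.indepFun hab
  have hmul := hi.integral_fun_comp_mul_comp (μ := ν) (𝕜 := ℂ)
    (f := fun s : ℝ => Complex.exp ((1 + Complex.I * c) * s))
    (g := fun s : ℝ => Complex.exp (Complex.I * s))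
    (measurable_extension_apply _).aemeasurable (measurable_extension_apply _).aemeasurable
    (by apply Continuous.aestronglyMeasurable; fun_prop)
    (by apply Continuous.aestronglyMeasurable; fun_prop)
  rw [hν.integral_cexp_mul, hν.integral_cexp_mul, ← Complex.exp_add] at hmul
  have hb : b = b' + c • a := by simp [hb']
  have e1 : (inner ℝ a b : ℝ) = c * ‖a‖ ^ 2 := by rw [← hca, real_inner_self_eq_norm_sq]
  have e2 : (inner ℝ b b : ℝ) = ‖b'‖ ^ 2 + c ^ 2 * ‖a‖ ^ 2 := by
    rw [hb, inner_add_left, inner_add_right, inner_add_right, inner_smul_left, inner_smul_right,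
      inner_smul_right, inner_smul_left, real_inner_comm a b', hab, real_inner_self_eq_norm_sq,
      real_inner_self_eq_norm_sq]
    simp; ring
  calc _ = ∫ x : Extension E, Complex.exp ((1 + Complex.I * c) * (x (innerSL ℝ a) : ℝ))
        * Complex.exp (Complex.I * (x (innerSL ℝ b') : ℝ)) ∂ν := by
        refine integral_congr_ae (ae_of_all _ fun x => ?_)
        simp only [← Complex.exp_add]
        congr 1
        rw [hb]
        simp
        ring
    _ = _ := hmul
    _ = _ := by
        congr 1
        rw [innerSL_apply_norm, innerSL_apply_norm, e1, e2, real_inner_self_eq_norm_sq]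
        push_cast
        linear_combination ((v : ℂ) / 2 * ‖b'‖ ^ 2 + (v : ℂ) / 2 * ‖a‖ ^ 2 * c ^ 2)
          * Complex.I_sq

theorem memLp_cexp (hν : IsCanonicalGaussian v ν) (a b : StrongDual ℝ E) (c : ℂ) :
    MemLp (fun x => Complex.exp (c + ((x a : ℝ) + Complex.I * (x b : ℝ)))) 2 ν := by
  have hm : Measurable fun x : Extension E =>
    Complex.exp (c + ((x a : ℝ) + Complex.I * (x b : ℝ))) := by fun_prop
  rw [memLp_two_iff_integrable_sq_norm hm.aestronglyMeasurable]
  refine ((hν.integrable_exp ((2 : ℝ) • a)).const_mul (Real.exp (2 * c.re))).congr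
    (ae_of_all _ fun x => ?_)
  simp only [Complex.norm_exp]
  rw [← Real.exp_nat_mul, ← Real.exp_add]
  congr 1
  simp
  ring

/-- The density of the translated Gaussian measure. -/
theorem measurePreserving_add_incl (hν : IsCanonicalGaussian v ν) [CompleteSpace E]
    (hv : v ≠ 0) (e : E) :
    MeasurePreserving (fun x : Extension E => x + Extension.incl E e)
      (ν.withDensity fun x => ENNReal.ofReal
        (Real.exp (-(x (innerSL ℝ e)) / v - inner ℝ e e / (2 * v)))) ν := by
  have := hν.isProbabilityMeasure
  have hmT := Extension.measurable_add_const (Extension.incl E e)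
  refine ⟨hmT, ?_⟩
  have hd : Integrable (fun x : Extension E =>
      Real.exp (-(x (innerSL ℝ e)) / v - inner ℝ e e / (2 * v))) ν := by
    refine ((hν.integrable_exp ((-1 / v : ℝ) • innerSL ℝ e)).mul_const
      (Real.exp (-(inner ℝ e e / (2 * v))))).congr (ae_of_all _ fun x => ?_)
    simp only [← Real.exp_add]
    congr 1
    simp
    ring
  have := isFiniteMeasure_withDensity_ofReal hd.2
  have hv' : (v : ℂ) ≠ 0 := by exact_mod_cast hv
  refine Extension.ext_of_integral_cexp fun ℓ => ?_
  obtain ⟨l, rfl⟩ := (InnerProductSpace.toDual ℝ E).surjective ℓ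
  have hl : ∀ u : Extension E, u (InnerProductSpace.toDual ℝ E l) = u (innerSL ℝ l) := fun u => rfl
  have hie : Extension.incl E e (innerSL ℝ l) = inner ℝ l e := rfl
  simp only [hl]
  rw [integral_map hmT.aemeasurable (Measurable.aestronglyMeasurable (by fun_prop)),
    integral_withDensity_eq_integral_toReal_smul (by fun_prop)
      (ae_of_all _ fun _ => ENNReal.ofReal_lt_top)]
  have h0 := hν.integral_cexp 0 l
  -- The density contributes the real exponent `-⟨x, e⟩ / v`, so the tilted characteristic
  -- functional is a Gaussian exponential integral with `a = -e / v`.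
  have h1 := hν.integral_cexp ((-1 / v : ℝ) • e) l
  have e1 : ∫ x : Extension E, Complex.exp ((x (innerSL ℝ l) : ℝ) * Complex.I) ∂ν =
      ∫ x : Extension E,
        Complex.exp ((x (innerSL ℝ 0) : ℝ) + Complex.I * (x (innerSL ℝ l) : ℝ)) ∂ν := by
    simp [mul_comm]
  rw [e1, h0]
  calc _ = ∫ x : Extension E, Complex.exp (Complex.I * (inner ℝ l e : ℝ)
        - (inner ℝ e e : ℝ) / (2 * v)) * Complex.exp ((x (innerSL ℝ ((-1 / v : ℝ) • e)) : ℝ)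
          + Complex.I * (x (innerSL ℝ l) : ℝ)) ∂ν := by
        refine integral_congr_ae (ae_of_all _ fun x => ?_)
        simp only [ENNReal.toReal_ofReal (Real.exp_pos _).le, Complex.real_smul,
          LinearMap.add_apply, hie, Complex.ofReal_exp, ← Complex.exp_add]
        congr 1
        simp
        ring
    _ = _ := by
        rw [integral_const_mul, h1, ← Complex.exp_add]
        congr 1
        simp only [inner_smul_left, inner_smul_right, inner_zero_left, real_inner_comm e l]
        push_cast
        simp
        field_simp
        ring

theorem quasiMeasurePreserving_add_incl (hν : IsCanonicalGaussian v ν) [CompleteSpace E]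
    (hv : v ≠ 0) (e : E) :
    Measure.QuasiMeasurePreserving (fun x : Extension E => x + Extension.incl E e) ν ν := by
  have hp := hν.measurePreserving_add_incl hv e
  refine ⟨hp.measurable, ?_⟩
  conv_rhs => rw [← hp.map_eq]
  -- The density is strictly positive, so `ν` is absolutely continuous with respect to the weighted
  -- measure whose image is `ν`.
  refine Measure.AbsolutelyContinuous.map (withDensity_absolutelyContinuous' ?_ ?_) hp.measurable
  · exact Measurable.aemeasurable (by fun_prop)
  · exact ae_of_all _ fun x => by simp [Real.exp_pos]

/-- Translation followed by multiplication with a square root of the density is isometric. -/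
theorem eLpNorm_translate_mul (hν : IsCanonicalGaussian v ν) [CompleteSpace E] (hv : v ≠ 0)
    (e : E) {f K : Extension E → ℂ}
    (hf : AEStronglyMeasurable f ν)
    (hK : ∀ x, ‖K x‖ ^ 2 = Real.exp (-(x (innerSL ℝ e)) / v - inner ℝ e e / (2 * v))) :
    eLpNorm (fun x => f (x + Extension.incl E e) * K x) 2 ν = eLpNorm f 2 ν := by
  have hp := hν.measurePreserving_add_incl hv e
  rw [eLpNorm_eq_lintegral_rpow_enorm_toReal (by norm_num) (by norm_num),
    eLpNorm_eq_lintegral_rpow_enorm_toReal (by norm_num) (by norm_num)]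
  congr 1
  have hfm : AEMeasurable (fun x => ‖f x‖ₑ ^ (2 : ℝ≥0∞).toReal) ν := hf.enorm.pow_const _
  have hfm' := hfm
  rw [← hp.map_eq] at hfm'
  conv_rhs => rw [← hp.map_eq]
  rw [lintegral_map' hfm' hp.measurable.aemeasurable]
  refine Eq.trans ?_ (lintegral_withDensity_eq_lintegral_mul₀'
    (Measurable.aemeasurable (by fun_prop))
    (hfm'.comp_aemeasurable hp.measurable.aemeasurable)).symm
  refine lintegral_congr fun x => ?_
  simp only [Pi.mul_apply, enorm_mul, ← hK]
  simp [mul_pow, mul_comm]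

end IsCanonicalGaussian

end GaussianCalculus

/-! ### Linear algebra of the polarization. -/

variable {L A : Type*} [AddCommGroup L] [Module ℝ L] [AddTorsor L A] {T : Theory L A}

theorem Theory.bracketQ_q (T : Theory L A) (ξ τ : L) : T.bracketQ ξ (T.q τ) = T.bracket ξ τ := rfl

theorem Theory.ω_apply (T : Theory L A) (ξ τ : L) :
    T.ω ξ τ = 1 / 2 * (T.bracketQ ξ (T.q τ) - T.bracketQ τ (T.q ξ)) := rfl

theorem Theory.q_eq_zero_iff (T : Theory L A) {ξ : L} : T.q ξ = 0 ↔ ξ ∈ T.M :=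
  Submodule.Quotient.mk_eq_zero _

theorem Theory.q_surjective (T : Theory L A) : Function.Surjective T.q :=
  Submodule.mkQ_surjective _

theorem Theory.bracketQ_add (T : Theory L A) (ξ τ : L) (φ : T.Q) :
    T.bracketQ (ξ + τ) φ = T.bracketQ ξ φ + T.bracketQ τ φ := by
  obtain ⟨σ, rfl⟩ := T.q_surjective φ
  simp [T.bracketQ_q]

theorem Theory.bracketQ_smul (T : Theory L A) (c : ℝ) (ξ : L) (φ : T.Q) :
    T.bracketQ (c • ξ) φ = c * T.bracketQ ξ φ := by
  obtain ⟨σ, rfl⟩ := T.q_surjective φ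
  simp [T.bracketQ_q]

/-- A vector `ξ` is determined by its class in `Q` and by the linear form `[ξ, ·]` on `Q`. -/
theorem Theory.eq_zero_of_q_of_bracketQ (T : Theory L A) {ξ : L} (hq : T.q ξ = 0)
    (hb : ∀ φ, T.bracketQ ξ φ = 0) : ξ = 0 := by
  refine T.nondegenerate ξ fun τ => ?_
  change T.ω ξ τ = 0
  rw [T.ω_apply, hb, hq, map_zero]
  simp

/-- Classes in `Q` and linear forms on `Q` can be prescribed independently. -/
theorem Theory.exists_q_eq_bracketQ_eq (T : Theory L A) (ψ : T.Q) (ξ : L) :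
    ∃ τ, T.q τ = ψ ∧ ∀ φ, T.bracketQ τ φ = T.bracketQ ξ φ := by
  obtain ⟨σ, rfl⟩ := T.q_surjective ψ
  have h1 : ξ - σ ∈ LinearMap.ker T.bracket.flip ⊔ LinearMap.ker T.bracket := by
    rw [T.span]; trivial
  obtain ⟨m, hm, n, hn, hmn⟩ := Submodule.mem_sup.1 h1
  refine ⟨σ + m, ?_, fun φ => ?_⟩
  · rw [map_add, T.q_eq_zero_iff.2 hm, add_zero]
  · obtain ⟨τ, rfl⟩ := T.q_surjective φ
    have hn' : T.bracket n τ = 0 := by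
      rw [LinearMap.mem_ker.1 hn]; rfl
    rw [T.bracketQ_q, T.bracketQ_q, eq_add_of_sub_eq' hmn.symm]
    simp [hn']

/-! ### The momentum-position splitting of `L` and the complex structure determined by `Ω`. -/

namespace VacuumForm

variable {Ω : VacuumForm T}

theorem form_eq (φ φ' : T.Q) :
    Ω.form φ φ' = (Ω.reForm.form φ φ' : ℝ) + Complex.I * ((Ω.form φ φ').im : ℝ) := by
  rw [mul_comm]
  exact (Complex.re_add_im _).symm

theorem eq_of_reForm {φ ψ : T.Q} (h : ∀ φ', Ω.reForm.form φ φ' = Ω.reForm.form ψ φ') : φ = ψ := by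
  rw [← sub_eq_zero]
  by_contra hne
  refine (Ω.reForm.pos _ hne).ne' ?_
  rw [Ω.reForm.form.map_sub, LinearMap.sub_apply, h, sub_self]

namespace IsAdmissible

variable (hΩ : Ω.IsAdmissible)

/-- The continuous linear form `[ξ, ·] + Im Ω(q ξ, ·)`. -/
def momentumDual : L →ₗ[ℝ] StrongDual ℝ Ω.Space where
  toFun ξ := hΩ.bracketDual ξ + hΩ.imDual (T.q ξ)
  map_add' ξ τ := by
    ext φ'
    obtain ⟨φ, rfl⟩ := Ω.toSpace.surjective φ'
    change T.bracketQ (ξ + τ) φ + (Ω.form (T.q (ξ + τ)) φ).im =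
      T.bracketQ ξ φ + (Ω.form (T.q ξ) φ).im + (T.bracketQ τ φ + (Ω.form (T.q τ) φ).im)
    rw [T.bracketQ_add, map_add, map_add, LinearMap.add_apply, Complex.add_im]
    ring
  map_smul' c ξ := by
    ext φ'
    obtain ⟨φ, rfl⟩ := Ω.toSpace.surjective φ'
    change T.bracketQ (c • ξ) φ + (Ω.form (T.q (c • ξ)) φ).im =
      c * (T.bracketQ ξ φ + (Ω.form (T.q ξ) φ).im)
    rw [T.bracketQ_smul, map_smul, map_smul, LinearMap.smul_apply, Complex.smul_im, smul_eq_mul]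
    ring

/-- The momentum component of a vector: `Re Ω(p ξ, φ) = [ξ, φ] + Im Ω(q ξ, φ)`. -/
def p : L →ₗ[ℝ] T.Q :=
  haveI := hΩ.complete
  Ω.toSpace.symm.toLinearMap ∘ₗ
    (InnerProductSpace.toDual ℝ Ω.Space).symm.toLinearEquiv.toLinearMap ∘ₗ hΩ.momentumDual

theorem innerSL_p (ξ : L) : innerSL ℝ (Ω.toSpace (hΩ.p ξ)) = hΩ.momentumDual ξ := by
  have := hΩ.complete
  exact (InnerProductSpace.toDual ℝ Ω.Space).apply_symm_apply (hΩ.momentumDual ξ)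

theorem reForm_p (ξ : L) (φ : T.Q) :
    Ω.reForm.form (hΩ.p ξ) φ = T.bracketQ ξ φ + (Ω.form (T.q ξ) φ).im :=
  congrArg (fun ℓ : StrongDual ℝ Ω.Space => ℓ (Ω.toSpace φ)) (hΩ.innerSL_p ξ)

theorem bracketQ_eq (ξ : L) (φ : T.Q) :
    T.bracketQ ξ φ = Ω.reForm.form (hΩ.p ξ) φ - (Ω.form (T.q ξ) φ).im := by
  rw [hΩ.reForm_p]; ring

/-- The contribution of `Im Ω` is symmetric and drops out of the antisymmetrization, so `p` and `q`
behave like canonical coordinates. -/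
theorem ω_eq (ξ τ : L) : T.ω ξ τ =
    1 / 2 * (Ω.reForm.form (hΩ.p ξ) (T.q τ) - Ω.reForm.form (hΩ.p τ) (T.q ξ)) := by
  rw [T.ω_apply, hΩ.bracketQ_eq, hΩ.bracketQ_eq, Ω.symm (T.q τ) (T.q ξ)]
  ring

theorem injective_p_prod_q : Function.Injective (hΩ.p.prod T.q) := by
  rw [injective_iff_map_eq_zero]
  intro ξ h
  have hp : hΩ.p ξ = 0 := congrArg Prod.fst h
  have hq : T.q ξ = 0 := congrArg Prod.snd h
  refine T.eq_zero_of_q_of_bracketQ hq fun φ => ?_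
  rw [hΩ.bracketQ_eq, hp, hq]
  simp

theorem surjective_p_prod_q : Function.Surjective (hΩ.p.prod T.q) := by
  rintro ⟨φ, ψ⟩
  -- Admissibility provides a `ξ` whose form `[ξ, ·]` gives momentum `φ` once the class in `Q` is
  -- `ψ`; `M + N = L` then allows that class to be prescribed without changing the form.
  obtain ⟨ξ, hξ⟩ := hΩ.exists_bracket (innerSL ℝ (Ω.toSpace φ) - hΩ.imDual ψ)
  obtain ⟨τ, hτ, hτ'⟩ := T.exists_q_eq_bracketQ_eq ψ ξ
  refine ⟨τ, Prod.ext (Ω.eq_of_reForm fun φ' => ?_) hτ⟩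
  change Ω.reForm.form (hΩ.p τ) φ' = Ω.reForm.form φ φ'
  have h : Ω.reForm.form φ φ' - (Ω.form ψ φ').im = T.bracketQ ξ φ' := hξ (Ω.toSpace φ')
  rw [hΩ.reForm_p, hτ, hτ', ← h]
  ring

/-- The decomposition of `L` into momenta and positions. -/
def splitting : L ≃ₗ[ℝ] T.Q × T.Q :=
  LinearEquiv.ofBijective (hΩ.p.prod T.q) ⟨hΩ.injective_p_prod_q, hΩ.surjective_p_prod_q⟩

theorem ext_p_q {ξ τ : L} (hp : hΩ.p ξ = hΩ.p τ) (hq : T.q ξ = T.q τ) : ξ = τ :=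
  hΩ.injective_p_prod_q (Prod.ext hp hq)

@[simp]
theorem p_splitting_symm (x : T.Q × T.Q) : hΩ.p (hΩ.splitting.symm x) = x.1 :=
  congrArg Prod.fst (hΩ.splitting.apply_symm_apply x)

@[simp]
theorem q_splitting_symm (x : T.Q × T.Q) : T.q (hΩ.splitting.symm x) = x.2 :=
  congrArg Prod.snd (hΩ.splitting.apply_symm_apply x)

/-- The complex structure that corresponds to `Ω`. -/
def complexStructure : ComplexStructure T where
  J := hΩ.splitting.symm.toLinearMap ∘ₗ LinearMap.prod (-T.q) hΩ.p
  sq ξ := hΩ.ext_p_q (by simp) (by simp)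
  symplectic ξ τ := by
    rw [hΩ.ω_eq, hΩ.ω_eq]
    simp [Ω.reForm.symm (T.q _)]
    ring
  pos ξ hξ := by
    rw [hΩ.ω_eq]
    simp only [LinearMap.comp_apply, LinearMap.prod_apply, LinearEquiv.coe_coe, Function.prod_apply,
      p_splitting_symm, q_splitting_symm, LinearMap.neg_apply, map_neg]
    have h1 : ∀ φ, 0 ≤ Ω.reForm.form φ φ := fun φ => by
      by_cases h : φ = 0
      · simp [h]
      · exact (Ω.reForm.pos φ h).le
    by_cases hp : hΩ.p ξ = 0
    · have hq : T.q ξ ≠ 0 := fun hq => hξ (hΩ.ext_p_q (by simpa using hp) (by simpa using hq))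
      have := Ω.reForm.pos _ hq
      have := h1 (hΩ.p ξ)
      linarith
    · have := Ω.reForm.pos _ hp
      have := h1 (T.q ξ)
      linarith

theorem p_complexStructure (ξ : L) : hΩ.p (hΩ.complexStructure.J ξ) = -T.q ξ := by
  simp [complexStructure]

theorem q_complexStructure (ξ : L) : T.q (hΩ.complexStructure.J ξ) = hΩ.p ξ := by
  simp [complexStructure]

/-- The hypotheses are the two formulas for `J` rather than correspondence, because this computation
is needed to prove that the constructed `J` corresponds to `Ω`. -/
theorem g_eq_of_p_of_q (J : ComplexStructure T) (hp : ∀ ξ, hΩ.p (J.J ξ) = -T.q ξ)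
    (hq : ∀ ξ, T.q (J.J ξ) = hΩ.p ξ) (ξ τ : L) : J.g.form ξ τ =
      Ω.reForm.form (hΩ.p ξ) (hΩ.p τ) + Ω.reForm.form (T.q ξ) (T.q τ) := by
  have : J.g.form ξ τ = 2 * T.ω ξ (J.J τ) := rfl
  rw [this, hΩ.ω_eq, hp, hq, map_neg, LinearMap.neg_apply, Ω.reForm.symm (T.q τ)]
  ring

theorem corresponds_complexStructure : hΩ.complexStructure.Corresponds Ω := by
  refine ⟨hΩ.splitting.symm.toLinearMap ∘ₗ LinearMap.inr ℝ T.Q T.Q, fun φ => by simp, fun φ => ?_,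
    fun φ φ' => ?_⟩
  · refine ⟨hΩ.splitting.symm (φ, 0), T.q_eq_zero_iff.1 (by simp), hΩ.ext_p_q ?_ ?_⟩
    · simp [p_complexStructure]
    · simp [q_complexStructure]
  · rw [hΩ.g_eq_of_p_of_q _ hΩ.p_complexStructure hΩ.q_complexStructure, hΩ.bracketQ_eq, Ω.form_eq]
    simp

/-- This is the uniqueness of `J`. The imaginary part of the correspondence says that `j` has values
of momentum zero, the real part that `J` sends `j φ` to the element of `M` with momentum `-φ`; these
vectors span `L`. -/
theorem p_q_of_corresponds {J : ComplexStructure T} (hJ : J.Corresponds Ω) :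
    (∀ ξ, hΩ.p (J.J ξ) = -T.q ξ) ∧ ∀ ξ, T.q (J.J ξ) = hΩ.p ξ := by
  obtain ⟨j, hqj, hjM, hform⟩ := hJ
  -- As `j φ = J m` with `m ∈ M`, applying `J` once more gives `-m`, whose class is zero.
  have hqJ : ∀ φ, T.q (J.J (j φ)) = 0 := fun φ => by
    obtain ⟨m, hm, hmj⟩ := hjM φ
    rw [← hmj, J.sq, map_neg, T.q_eq_zero_iff.2 hm, neg_zero]
  have hpj : ∀ φ, hΩ.p (j φ) = 0 := fun φ => by
    refine Ω.eq_of_reForm fun φ' => ?_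
    have h := congrArg Complex.im (hform φ φ')
    rw [hΩ.reForm_p, hqj, h]
    simp
  have hpJ : ∀ φ, hΩ.p (J.J (j φ)) = -φ := fun φ => by
    refine Ω.eq_of_reForm fun φ' => ?_
    have h : Ω.reForm.form φ φ' = J.g.form (j φ) (j φ') := by
      have h := congrArg Complex.re (hform φ φ')
      simpa using! h
    have h2 : J.g.form (j φ') (j φ) = 2 * T.ω (j φ') (J.J (j φ)) := rfl
    rw [J.g.symm, h2, hΩ.ω_eq, hpj, hqj] at h
    rw [map_neg, LinearMap.neg_apply, h]
    simp
  have hξ : ∀ ξ, ξ = j (T.q ξ) - J.J (j (hΩ.p ξ)) := fun ξ =>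
    hΩ.ext_p_q (by simp [hpj, hpJ]) (by simp [hqj, hqJ])
  have hJξ : ∀ ξ, J.J ξ = J.J (j (T.q ξ)) + j (hΩ.p ξ) := fun ξ => by
    conv_lhs => rw [hξ ξ, map_sub, J.sq, sub_neg_eq_add]
  exact ⟨fun ξ => by rw [hJξ, map_add, hpJ, hpj, add_zero],
    fun ξ => by rw [hJξ, map_add, hqJ, hqj, zero_add]⟩

theorem g_eq {J : ComplexStructure T} (hJ : J.Corresponds Ω) (ξ τ : L) : J.g.form ξ τ =
    Ω.reForm.form (hΩ.p ξ) (hΩ.p τ) + Ω.reForm.form (T.q ξ) (T.q τ) :=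
  hΩ.g_eq_of_p_of_q J (hΩ.p_q_of_corresponds hJ).1 (hΩ.p_q_of_corresponds hJ).2 ξ τ

theorem eq_complexStructure {J : ComplexStructure T} (hJ : J.Corresponds Ω) :
    J = hΩ.complexStructure := by
  ext ξ
  refine hΩ.ext_p_q ?_ ?_
  · rw [hΩ.p_complexStructure, (hΩ.p_q_of_corresponds hJ).1]
  · rw [hΩ.q_complexStructure, (hΩ.p_q_of_corresponds hJ).2]

/-- The Hilbert space `L` is the orthogonal sum of two copies of `Q`. -/
def splittingIsometry : hΩ.complexStructure.Space ≃ₗᵢ[ℝ] WithLp 2 (Ω.Space × Ω.Space) where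
  toLinearEquiv := hΩ.complexStructure.toSpace.symm ≪≫ₗ hΩ.splitting ≪≫ₗ
    (Ω.toSpace.prodCongr Ω.toSpace) ≪≫ₗ (WithLp.linearEquiv 2 ℝ (Ω.Space × Ω.Space)).symm
  norm_map' ξ := by
    rw [← sq_eq_sq₀ (norm_nonneg _) (norm_nonneg _), ← real_inner_self_eq_norm_sq,
      ← real_inner_self_eq_norm_sq, WithLp.prod_inner_apply]
    exact (hΩ.g_eq hΩ.corresponds_complexStructure ξ ξ).symm

theorem isAdmissible_complexStructure : hΩ.complexStructure.IsAdmissible := by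
  have hc := hΩ.complete
  have hs := hΩ.separable
  let e := hΩ.splittingIsometry
  have hsec : SecondCountableTopology Ω.Space := UniformSpace.secondCountable_of_separable _
  refine ⟨?_, ?_, ?_⟩
  · exact (completeSpace_congr (e := e.toEquiv) e.isometry.isUniformEmbedding).2 inferInstance
  · have : TopologicalSpace.SeparableSpace (WithLp 2 (Ω.Space × Ω.Space)) :=
      (WithLp.homeomorphProd 2 Ω.Space Ω.Space).symm.surjective.denseRange.separableSpace
        (WithLp.homeomorphProd 2 Ω.Space Ω.Space).symm.continuous
    exact e.symm.surjective.denseRange.separableSpace e.symm.continuous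
  -- In the components of the splitting the bracket is an inner product minus `Im Ω`, both jointly
  -- continuous.
  · have h : ∀ x : hΩ.complexStructure.Space × hΩ.complexStructure.Space,
        T.bracket (hΩ.complexStructure.toSpace.symm x.1) (hΩ.complexStructure.toSpace.symm x.2) =
        inner ℝ (e x.1).fst (e x.2).snd - Ω.imLeft (Ω.toSpace.symm (e x.1).snd) (e x.2).snd :=
      fun x => hΩ.bracketQ_eq (hΩ.complexStructure.toSpace.symm x.1)
        (T.q (hΩ.complexStructure.toSpace.symm x.2))
    simp only [h]
    have h1 : Continuous fun y : WithLp 2 (Ω.Space × Ω.Space) => y.fst := by fun_prop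
    have h2 : Continuous fun y : WithLp 2 (Ω.Space × Ω.Space) => y.snd := by fun_prop
    refine Continuous.sub ?_ ?_
    · exact (h1.comp (e.continuous.comp continuous_fst)).inner
        (h2.comp (e.continuous.comp continuous_snd))
    · exact hΩ.continuous_im.comp ((h2.comp (e.continuous.comp continuous_fst)).prodMk
        (h2.comp (e.continuous.comp continuous_snd)))

theorem existsUnique_complexStructure (hΩ : Ω.IsAdmissible) :
    ∃! J : ComplexStructure T, J.IsAdmissible ∧ J.Corresponds Ω :=
  ⟨hΩ.complexStructure, ⟨hΩ.isAdmissible_complexStructure, hΩ.corresponds_complexStructure⟩,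
    fun _ hJ => hΩ.eq_complexStructure hJ.2⟩

end IsAdmissible

end VacuumForm

/-! ### The Schrödinger representation: change of base point, Gram matrix and totality. -/

theorem Theory.θ_eq (T : Theory L A) (η η' : A) (ξ : L) :
    T.θ η' ξ = T.θ η ξ + T.bracket (η' -ᵥ η) ξ := by
  have := T.equivariant η (η' -ᵥ η) ξ
  rwa [vsub_vadd] at this

namespace VacuumForm.IsAdmissible

variable {Ω : VacuumForm T} (hΩ : Ω.IsAdmissible)

theorem isCanonicalGaussian_νQ (hΩ : Ω.IsAdmissible) : IsCanonicalGaussian (1 / 2) Ω.νQ :=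
  haveI := hΩ.complete
  isCanonicalGaussian_gaussian (1 / 2)

theorem isProbabilityMeasure_νQ (hΩ : Ω.IsAdmissible) : IsProbabilityMeasure Ω.νQ :=
  hΩ.isCanonicalGaussian_νQ.isProbabilityMeasure

/-- The two imaginary terms `[v, ·]` and `Im Ω(q v, ·)` merge into the pairing with `p v`, which
puts the wave function in the form required by the Gaussian integral formulas. -/
theorem coherent_eq (τ η : A) (φ : Ω.QHat) :
    hΩ.coherent τ η φ = Complex.exp (
      (Complex.I * (T.θ τ (η -ᵥ τ) : ℝ) - 1 / 2 * Ω.form (T.q (η -ᵥ τ)) (T.q (η -ᵥ τ)))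
      + ((φ (innerSL ℝ (Ω.toSpace (-T.q (η -ᵥ τ)))) : ℝ)
        + Complex.I * (φ (innerSL ℝ (Ω.toSpace (-hΩ.p (η -ᵥ τ)))) : ℝ))) := by
  rw [coherent, map_neg Ω.toSpace (hΩ.p _), map_neg (innerSL ℝ) (Ω.toSpace (hΩ.p _)),
    hΩ.innerSL_p]
  have : hΩ.momentumDual (η -ᵥ τ) = hΩ.bracketDual (η -ᵥ τ) + hΩ.imDual (T.q (η -ᵥ τ)) := rfl
  rw [this]
  congr 1
  simp
  ring

theorem memLp_coherent (τ η : A) : MemLp (hΩ.coherent τ η) 2 Ω.νQ := by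
  have := hΩ.isCanonicalGaussian_νQ.memLp_cexp (innerSL ℝ (Ω.toSpace (-T.q (η -ᵥ τ))))
    (innerSL ℝ (Ω.toSpace (-hΩ.p (η -ᵥ τ))))
    (Complex.I * (T.θ τ (η -ᵥ τ) : ℝ) - 1 / 2 * Ω.form (T.q (η -ᵥ τ)) (T.q (η -ᵥ τ)))
  refine this.congr_norm ?_ ?_
  · refine this.1.congr (ae_of_all _ fun φ => ?_)
    rw [coherent_eq]
  · exact ae_of_all _ fun φ => by rw [coherent_eq]

@[simp]
theorem coherent_self (η : A) (φ : Ω.QHat) : hΩ.coherent η η φ = 1 := by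
  rw [coherent_eq]
  simp

/-- The transformation law of the reduced wave functions of coherent states. -/
theorem coherent_cocycle (τ η η' : A) (φ : Ω.QHat) :
    hΩ.coherent τ η' φ =
      hΩ.coherent τ η (φ + Ω.incl (T.q (η' -ᵥ η))) * hΩ.coherent η η' φ := by
  have hv : η' -ᵥ τ = (η -ᵥ τ) + (η' -ᵥ η) := by
    rw [add_comm, vsub_add_vsub_cancel]
  rw [coherent_eq, coherent_eq, coherent_eq, ← Complex.exp_add, hv, T.θ_eq τ η]
  generalize η -ᵥ τ = v
  generalize η' -ᵥ η = w
  have h1 : Ω.incl (T.q w) (innerSL ℝ (Ω.toSpace (T.q v))) = Ω.reForm.form (T.q v) (T.q w) := rfl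
  have h2 : Ω.incl (T.q w) (innerSL ℝ (Ω.toSpace (hΩ.p v))) = Ω.reForm.form (hΩ.p v) (T.q w) := rfl
  have h3 := Ω.form_eq (T.q v) (T.q w)
  simp only [map_add, map_neg, LinearMap.add_apply, h1, h2, hΩ.reForm_p v, T.bracketQ_q,
    Ω.symm (T.q w) (T.q v)]
  congr 1
  push_cast
  -- The shift contributes `-i [v, w] - Ω(q v, q w)`: the bracket cancels against the change of `θ`,
  -- and the rest is the cross term of the quadratic exponent.
  linear_combination -h3

/-- With variance `1 / 2` this is precisely the density for translation by `q(η' - η)`, hence the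
change of base point is isometric. -/
theorem norm_sq_coherent (η η' : A) (φ : Ω.QHat) :
    ‖hΩ.coherent η η' φ‖ ^ 2 =
      Real.exp (-(φ (innerSL ℝ (Ω.toSpace (T.q (η' -ᵥ η))))) / (1 / 2 : ℝ≥0)
        - inner ℝ (Ω.toSpace (T.q (η' -ᵥ η))) (Ω.toSpace (T.q (η' -ᵥ η)))
          / (2 * (1 / 2 : ℝ≥0))) := by
  rw [coherent_eq, Complex.norm_exp, ← Real.exp_nat_mul]
  have h : inner ℝ (Ω.toSpace (T.q (η' -ᵥ η))) (Ω.toSpace (T.q (η' -ᵥ η)))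
    = (Ω.form (T.q (η' -ᵥ η)) (T.q (η' -ᵥ η))).re := rfl
  rw [h]
  congr 1
  simp
  ring

theorem quasiMeasurePreserving_add_incl (hΩ : Ω.IsAdmissible) (φ : T.Q) :
    Measure.QuasiMeasurePreserving (fun x => x + Ω.incl φ) Ω.νQ Ω.νQ :=
  haveI := hΩ.complete
  hΩ.isCanonicalGaussian_νQ.quasiMeasurePreserving_add_incl (by norm_num) (Ω.toSpace φ)

theorem eLpNorm_translate (η η' : A) {f : Ω.QHat → ℂ} (hf : AEStronglyMeasurable f Ω.νQ) :
    eLpNorm (fun φ => f (φ + Ω.incl (T.q (η' -ᵥ η))) * hΩ.coherent η η' φ) 2 Ω.νQ =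
      eLpNorm f 2 Ω.νQ :=
  haveI := hΩ.complete
  hΩ.isCanonicalGaussian_νQ.eLpNorm_translate_mul (by norm_num) (Ω.toSpace (T.q (η' -ᵥ η))) hf
    (hΩ.norm_sq_coherent η η')

theorem memLp_translate (η η' : A) {f : Ω.QHat → ℂ} (hf : MemLp f 2 Ω.νQ) :
    MemLp (fun φ => f (φ + Ω.incl (T.q (η' -ᵥ η))) * hΩ.coherent η η' φ) 2 Ω.νQ :=
  ⟨(hf.1.comp_quasiMeasurePreserving (hΩ.quasiMeasurePreserving_add_incl _)).mul
    (hΩ.memLp_coherent η η').1, by rw [hΩ.eLpNorm_translate η η' hf.1]; exact hf.2⟩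

/-- The wave functions of a state satisfy the transformation law almost everywhere. -/
theorem ae_eq_translate (Ψ : hΩ.stateSpace) (η η' : A) :
    (Ψ : A → Lp ℂ 2 Ω.νQ) η' =ᵐ[Ω.νQ] fun φ =>
      (Ψ : A → Lp ℂ 2 Ω.νQ) η (φ + Ω.incl (T.q (η' -ᵥ η))) * hΩ.coherent η η' φ := by
  obtain ⟨f, hf, hf'⟩ := Ψ.2
  filter_upwards [hf η', (hΩ.quasiMeasurePreserving_add_incl (T.q (η' -ᵥ η))).ae (hf η)]
    with φ h1 h2
  rw [h1, h2, hf']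

theorem norm_apply_eq (Ψ : hΩ.stateSpace) (η η' : A) :
    ‖(Ψ : A → Lp ℂ 2 Ω.νQ) η‖ = ‖(Ψ : A → Lp ℂ 2 Ω.νQ) η'‖ := by
  rw [Lp.norm_def, Lp.norm_def, eLpNorm_congr_ae (hΩ.ae_eq_translate Ψ η η'),
    hΩ.eLpNorm_translate η η' (Lp.aestronglyMeasurable _)]

/-- The state with a given `η`-reduced wave function. -/
theorem exists_state (η : A) (F : Lp ℂ 2 Ω.νQ) :
    ∃ Ψ : hΩ.stateSpace, (Ψ : A → Lp ℂ 2 Ω.νQ) η = F := by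
  have hm := fun η' => hΩ.memLp_translate η η' (Lp.memLp F)
  refine ⟨⟨fun η' => (hm η').toLp, fun η' φ => F (φ + Ω.incl (T.q (η' -ᵥ η))) * hΩ.coherent η η' φ,
    fun η' => (hm η').coeFn_toLp, fun η' η'' φ => ?_⟩, ?_⟩
  · beta_reduce
    rw [hΩ.coherent_cocycle η η' η'', ← mul_assoc, add_assoc φ, ← map_add, ← map_add,
      vsub_add_vsub_cancel]
  · refine Lp.ext ((hm η).coeFn_toLp.trans (ae_of_all _ fun φ => ?_))
    simp

/-- Passing to the `η`-reduced wave function. -/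
def reduce (η : A) : hΩ.stateSpace ≃ₗ[ℂ] Lp ℂ 2 Ω.νQ :=
  LinearEquiv.ofBijective (LinearMap.proj η ∘ₗ hΩ.stateSpace.subtype) <| by
    refine ⟨(injective_iff_map_eq_zero _).2 fun Ψ h => ?_, fun F => hΩ.exists_state η F⟩
    ext1
    funext η'
    have h0 : (Ψ : A → Lp ℂ 2 Ω.νQ) η = 0 := h
    have := hΩ.norm_apply_eq Ψ η' η
    rw [h0, norm_zero, norm_eq_zero] at this
    exact this

theorem norm_reduce (η η' : A) (Ψ : hΩ.stateSpace) : ‖hΩ.reduce η Ψ‖ = ‖hΩ.reduce η' Ψ‖ :=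
  hΩ.norm_apply_eq Ψ η η'

theorem inner_reduce (η η' : A) (Ψ Φ : hΩ.stateSpace) :
    inner ℂ (hΩ.reduce η Ψ) (hΩ.reduce η Φ) = inner ℂ (hΩ.reduce η' Ψ) (hΩ.reduce η' Φ) := by
  -- The change of base point preserves norms and is linear, hence preserves inner products.
  let U : Lp ℂ 2 Ω.νQ ≃ₗᵢ[ℂ] Lp ℂ 2 Ω.νQ :=
    { toLinearEquiv := (hΩ.reduce η').symm ≪≫ₗ hΩ.reduce η
      norm_map' := fun F => by simp [hΩ.norm_reduce η η'] }
  have := U.inner_map_map (hΩ.reduce η' Ψ) (hΩ.reduce η' Φ)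
  simpa [U] using! this

/-- The coherent state of `τ` in the Schrödinger representation. -/
def coherentState (τ : A) : hΩ.stateSpace :=
  ⟨fun η => (hΩ.memLp_coherent τ η).toLp, hΩ.coherent τ, fun η => (hΩ.memLp_coherent τ η).coeFn_toLp,
    fun η η' φ => hΩ.coherent_cocycle τ η η' φ⟩

theorem reduce_coherentState_ae (τ η : A) :
    hΩ.reduce η (hΩ.coherentState τ) =ᵐ[Ω.νQ] hΩ.coherent τ η :=
  (hΩ.memLp_coherent τ η).coeFn_toLp

theorem inner_reduce_coherentState_left (τ η : A) (F : Lp ℂ 2 Ω.νQ) :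
    inner ℂ (hΩ.reduce η (hΩ.coherentState τ)) F =
      ∫ φ, (starRingEnd ℂ) (hΩ.coherent τ η φ) * F φ ∂Ω.νQ := by
  rw [L2.inner_def]
  refine integral_congr_ae ?_
  filter_upwards [hΩ.reduce_coherentState_ae τ η] with φ h
  rw [h, RCLike.inner_apply, mul_comm]

/-- The Gram matrix of the coherent states. -/
theorem inner_reduce_coherentState {J : ComplexStructure T} (hJ : J.Corresponds Ω) (η ζ ζ' : A) :
    inner ℂ (hΩ.reduce η (hΩ.coherentState ζ)) (hΩ.reduce η (hΩ.coherentState ζ'))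
      = J.coherent ζ' ζ := by
  -- At the base point `ζ` the left factor is the constant 1, so only the mean of a single
  -- exponential remains.
  rw [hΩ.inner_reduce η ζ, inner_reduce_coherentState_left]
  have hG := hΩ.isCanonicalGaussian_νQ.integral_cexp (Ω.toSpace (-T.q (ζ -ᵥ ζ')))
    (Ω.toSpace (-hΩ.p (ζ -ᵥ ζ')))
  calc _ = ∫ φ, hΩ.coherent ζ' ζ φ ∂Ω.νQ := by
        refine integral_congr_ae ?_
        filter_upwards [hΩ.reduce_coherentState_ae ζ' ζ] with φ h
        rw [h]; simp
    _ = _ := by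
        simp only [coherent_eq]
        simp only [Complex.exp_add (_ - _)]
        rw [integral_const_mul, hG, ← Complex.exp_add, ComplexStructure.coherent, hΩ.g_eq hJ,
          T.θ_eq ζ' ζ, ← T.bracketQ_q]
        generalize ζ -ᵥ ζ' = v
        have hin : ∀ a b : T.Q, inner ℝ (Ω.toSpace a) (Ω.toSpace b) = Ω.reForm.form a b :=
          fun _ _ => rfl
        rw [hin, hin, hin,
          hΩ.bracketQ_eq, Ω.form_eq (T.q v) (T.q v), Ω.reForm.symm (hΩ.p v) (T.q v)]
        congr 1
        simp
        ring

/-- The coherent states are total. -/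
theorem span_reduce_coherentState (η : A) :
    (Submodule.span ℂ (Set.range fun τ => hΩ.reduce η (hΩ.coherentState τ))).topologicalClosure
      = ⊤ := by
  have := hΩ.complete
  have := hΩ.isProbabilityMeasure_νQ
  rw [Submodule.topologicalClosure_eq_top_iff, Submodule.eq_bot_iff]
  intro F hF
  have horth : ∀ τ, inner ℂ (hΩ.reduce η (hΩ.coherentState τ)) F = 0 := fun τ =>
    (Submodule.mem_orthogonal _ _).1 hF _ (Submodule.subset_span ⟨τ, rfl⟩)
  have hz : F =ᵐ[Ω.νQ] 0 := by
    refine ae_eq_zero_of_integral_cexp_mul ((Lp.memLp F).integrable (by norm_num)) fun ℓ => ?_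
    obtain ⟨l, rfl⟩ := (InnerProductSpace.toDual ℝ Ω.Space).surjective ℓ
    -- A purely momentum displacement: the coherent state of `η - v` is a phase times the character
    -- `exp (-i ⟨l, φ⟩)`, so orthogonality to it kills a Fourier coefficient of `F`.
    set v : L := hΩ.splitting.symm (Ω.toSpace.symm l, 0) with hv
    have h := horth (-v +ᵥ η)
    have hvs : η -ᵥ (-v +ᵥ η) = v := by rw [vsub_vadd_eq_vsub_sub]; simp
    rw [inner_reduce_coherentState_left] at h
    simp only [coherent_eq, hvs] at h
    set c : ℂ := Complex.exp (-(Complex.I * (T.θ (-v +ᵥ η) v : ℝ))) with hc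
    have hpq : T.q v = 0 := by simp [hv]
    have hpp : Ω.toSpace (hΩ.p v) = l := by simp [hv]
    have h2 : ∫ φ : Ω.QHat, c * (Complex.exp ((φ (InnerProductSpace.toDual ℝ Ω.Space l) : ℝ)
        * Complex.I) * F φ) ∂Ω.νQ = 0 := by
      rw [← h]
      refine integral_congr_ae (ae_of_all _ fun φ => ?_)
      have hl : φ (InnerProductSpace.toDual ℝ Ω.Space l) = φ (innerSL ℝ l) := rfl
      simp only [hpq, hc, ← Complex.exp_conj, ← mul_assoc, ← Complex.exp_add, map_neg, hpp, hl]
      congr 2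
      simp
      ring
    rw [integral_const_mul] at h2
    exact (mul_eq_zero.1 h2).resolve_left (Complex.exp_ne_zero _)
  exact (Lp.eq_zero_iff_ae_eq_zero).2 hz

end VacuumForm.IsAdmissible

/-! ### The holomorphic representation: rotations, the mean value property and the reproducing
kernel. -/

/-- On a finite-dimensional space of linear forms an element of the extension of `E` coincides with
an element of `E`. -/
theorem Extension.exists_inner_eq {E : Type*} [NormedAddCommGroup E] [InnerProductSpace ℝ E]
    (W : Submodule ℝ E) [FiniteDimensional ℝ W] (x : Extension E) :
    ∃ w ∈ W, ∀ a ∈ W, x (innerSL ℝ a) = inner ℝ a w := by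
  let u : W →ₗ[ℝ] ℝ := x ∘ₗ (innerSL ℝ).toLinearMap ∘ₗ W.subtype
  let w := (InnerProductSpace.toDual ℝ W).symm (LinearMap.toContinuousLinearMap u)
  refine ⟨w, w.2, fun a ha => ?_⟩
  have h : inner ℝ w (⟨a, ha⟩ : W) = u ⟨a, ha⟩ := InnerProductSpace.toDual_symm_apply
  rw [real_inner_comm]
  exact h.symm

theorem Theory.ω_swap (T : Theory L A) (ξ τ : L) : T.ω ξ τ = -T.ω τ ξ := by
  rw [T.ω_apply, T.ω_apply]; ring

namespace ComplexStructure

variable (J : ComplexStructure T)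

theorem g_apply (ξ τ : L) : J.g.form ξ τ = 2 * T.ω ξ (J.J τ) := rfl

theorem inner_toSpace (ξ τ : L) : inner ℝ (J.toSpace ξ) (J.toSpace τ) = J.g.form ξ τ := rfl

theorem g_J_J (ξ τ : L) : J.g.form (J.J ξ) (J.J τ) = J.g.form ξ τ := by
  rw [g_apply, g_apply, J.symplectic]

theorem g_J_right (ξ τ : L) : J.g.form ξ (J.J τ) = -(2 * T.ω ξ τ) := by
  rw [g_apply, J.sq, map_neg]; ring

theorem g_J_left (ξ τ : L) : J.g.form (J.J ξ) τ = 2 * T.ω ξ τ := by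
  rw [g_apply, J.symplectic]

theorem g_J_self (ξ : L) : J.g.form ξ (J.J ξ) = 0 := by
  have := T.ω_swap ξ ξ
  rw [g_J_right]; linarith

theorem coord_add (σ : L) (x y : J.LHat) : J.coord σ (x + y) = J.coord σ x + J.coord σ y := by
  simp only [coord, LinearMap.add_apply]
  push_cast
  ring

theorem coord_incl_self (σ : L) : J.coord σ (J.incl σ) = (J.g.form σ σ : ℝ) := by
  have := T.ω_swap σ σ
  have h0 : T.ω σ σ = 0 := by linarith
  rw [coord_incl, h0]
  simp

theorem measurable_coord (σ : L) : Measurable (J.coord σ) := by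
  unfold coord
  fun_prop

/-! #### Rotations -/

/-- `J` as an isometry of `(L, g)`. -/
def isometry : J.Space →ₗᵢ[ℝ] J.Space where
  toLinearMap := J.toSpace.toLinearMap ∘ₗ J.J ∘ₗ J.toSpace.symm.toLinearMap
  norm_map' x := by
    obtain ⟨ξ, rfl⟩ := J.toSpace.surjective x
    rw [← sq_eq_sq₀ (norm_nonneg _) (norm_nonneg _), ← real_inner_self_eq_norm_sq,
      ← real_inner_self_eq_norm_sq]
    exact J.g_J_J ξ ξ

/-- The extension of `J` to `L̂`. -/
def JHat (x : J.LHat) : J.LHat where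
  toFun ℓ := x (ℓ.comp J.isometry.toContinuousLinearMap)
  map_add' ℓ ℓ' := by rw [ContinuousLinearMap.add_comp, map_add]
  map_smul' c ℓ := by rw [ContinuousLinearMap.smul_comp, map_smul]; rfl

/-- The sign appears because `J` is skew-adjoint for `g`. -/
theorem JHat_innerSL (x : J.LHat) (σ : L) :
    J.JHat x (innerSL ℝ (J.toSpace σ)) = -x (innerSL ℝ (J.toSpace (J.J σ))) := by
  have : (innerSL ℝ (J.toSpace σ)).comp J.isometry.toContinuousLinearMap
      = -innerSL ℝ (J.toSpace (J.J σ)) := by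
    ext y
    obtain ⟨τ, rfl⟩ := J.toSpace.surjective y
    change J.g.form σ (J.J τ) = -J.g.form (J.J σ) τ
    rw [g_J_right, g_J_left]
  rw [← map_neg, ← this]
  rfl

/-- The rotation `exp (t J)` of `L̂`. -/
def rot (t : ℝ) (x : J.LHat) : J.LHat := Real.cos t • x + Real.sin t • J.JHat x

theorem rot_innerSL (t : ℝ) (x : J.LHat) (σ : L) :
    J.rot t x (innerSL ℝ (J.toSpace σ)) =
      x (innerSL ℝ (J.toSpace (Real.cos t • σ - Real.sin t • J.J σ))) := by
  simp only [rot, LinearMap.add_apply, LinearMap.smul_apply, JHat_innerSL, map_sub, map_smul,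
    smul_eq_mul]
  ring

theorem coord_rot (t : ℝ) (σ : L) (x : J.LHat) :
    J.coord σ (J.rot t x) = Complex.exp (t * Complex.I) * J.coord σ x := by
  simp only [coord, rot_innerSL, Complex.exp_mul_I, J.sq, map_sub, map_smul, map_neg, smul_eq_mul]
  push_cast
  linear_combination (-Complex.sin t * (x (innerSL ℝ (J.toSpace (J.J σ))) : ℝ)) * Complex.I_sq

theorem measurable_rot (t : ℝ) : Measurable (J.rot t) :=
  Extension.measurable_of_apply fun ℓ => by
    change Measurable fun x : J.LHat => Real.cos t • x ℓ
      + Real.sin t • x (ℓ.comp J.isometry.toContinuousLinearMap)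
    fun_prop

variable {J}

theorem IsAdmissible.isCanonicalGaussian (hJ : J.IsAdmissible) : IsCanonicalGaussian 1 J.νL :=
  haveI := hJ.complete
  isCanonicalGaussian_gaussian 1

/-- Since `J` is a `g`-isometry and `g(σ, J σ) = 0`, rotation preserves the norm of every linear
form, hence its law; these laws determine the canonical Gaussian measure. -/
theorem IsAdmissible.measurePreserving_rot (hJ : J.IsAdmissible) (t : ℝ) :
    MeasurePreserving (J.rot t) J.νL J.νL := by
  have := hJ.complete
  refine ⟨J.measurable_rot t, IsCanonicalGaussian.unique (v := 1) (fun ℓ => ?_)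
    hJ.isCanonicalGaussian⟩
  obtain ⟨l, rfl⟩ := (InnerProductSpace.toDual ℝ J.Space).surjective ℓ
  obtain ⟨σ, rfl⟩ := J.toSpace.surjective l
  have h : ((fun x : J.LHat => x (InnerProductSpace.toDual ℝ J.Space (J.toSpace σ))) ∘ J.rot t)
      = fun x => x (innerSL ℝ (J.toSpace (Real.cos t • σ - Real.sin t • J.J σ))) :=
    funext fun x => J.rot_innerSL t x σ
  have hn : ‖J.toSpace (Real.cos t • σ - Real.sin t • J.J σ)‖₊ = ‖J.toSpace σ‖₊ := by
    apply NNReal.eq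
    rw [coe_nnnorm, coe_nnnorm, ← sq_eq_sq₀ (norm_nonneg _) (norm_nonneg _),
      ← real_inner_self_eq_norm_sq, ← real_inner_self_eq_norm_sq, inner_toSpace, inner_toSpace]
    simp only [map_sub, map_smul, LinearMap.sub_apply, LinearMap.smul_apply, smul_eq_mul, g_J_self,
      J.g.symm (J.J σ) σ, g_J_J]
    linear_combination J.g.form σ σ * Real.cos_sq_add_sin_sq t
  rw [Measure.map_map (measurable_extension_apply _) (J.measurable_rot t), h,
    hJ.isCanonicalGaussian]
  congr 3
  rw [LinearIsometryEquiv.nnnorm_map, ← hn]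
  exact NNReal.eq (innerSL_apply_norm ℝ _)

/-- The mean value property: the Gaussian mean of a holomorphic cylinder function is its value
at the origin. -/
theorem IsHolCylinder.integral_eq (hJ : J.IsAdmissible) {f : J.LHat → ℂ} (hf : J.IsHolCylinder f)
    (hi : Integrable f J.νL) : ∫ x, f x ∂J.νL = f 0 := by
  have hprob := hJ.isCanonicalGaussian.isProbabilityMeasure
  have hrot : ∀ t, Integrable (fun x => f (J.rot t x)) J.νL := fun t =>
    (hJ.measurePreserving_rot t).integrable_comp_of_integrable hi
  have hrotI : ∀ t, ∫ x, f (J.rot t x) ∂J.νL = ∫ x, f x ∂J.νL := fun t => by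
    have h := hi.1
    rw [← (hJ.measurePreserving_rot t).map_eq] at h
    conv_rhs => rw [← (hJ.measurePreserving_rot t).map_eq]
    rw [integral_map (J.measurable_rot t).aemeasurable h]
  have hrotN : ∀ t, ∫ x, ‖f (J.rot t x)‖ ∂J.νL = ∫ x, ‖f x‖ ∂J.νL := fun t => by
    have h := hi.norm.1
    rw [← (hJ.measurePreserving_rot t).map_eq] at h
    conv_rhs => rw [← (hJ.measurePreserving_rot t).map_eq]
    rw [integral_map (J.measurable_rot t).aemeasurable h]
  obtain ⟨n, σ, p, hp, hfp⟩ := hf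
  have hfr : ∀ t x, f (J.rot t x) = p (Complex.exp (t * Complex.I) • fun i => J.coord (σ i) x) :=
    fun t x => by
      rw [hfp]
      congr 1
      funext i
      rw [coord_rot]
      rfl
  have hmeas : Measurable fun y : ℝ × J.LHat => f (J.rot y.1 y.2) := by
    simp only [hfr]
    refine hp.continuous.measurable.comp (measurable_pi_iff.2 fun i => ?_)
    have := (J.measurable_coord (σ i)).comp
      (measurable_snd : Measurable (Prod.snd : ℝ × J.LHat → J.LHat))
    exact Measurable.mul (by fun_prop) this
  -- Invariance makes the `L¹` norm over `x` independent of `t`, which justifies exchanging the two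
  -- integrals.
  have hprod : Integrable (Function.uncurry fun t x => f (J.rot t x))
      ((volume.restrict (Set.uIoc 0 (2 * Real.pi))).prod J.νL) := by
    refine (integrable_prod_iff hmeas.aestronglyMeasurable).2 ⟨ae_of_all _ hrot, ?_⟩
    simp only [hrotN]
    rw [Set.uIoc_of_le (by positivity)]
    exact integrable_const _
  have havg : ∀ x, ∫ t in (0 : ℝ)..(2 * Real.pi), f (J.rot t x) = (2 * Real.pi) * f 0 := by
    intro x
    -- Rotating `x` multiplies all coordinates by `exp (i t)`, so the orbit average of `f` is the
    -- circle average of an entire function of one variable.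
    let u : ℂ → ℂ := fun w => p (w • fun i => J.coord (σ i) x)
    have hu : Differentiable ℂ u := hp.comp (by fun_prop)
    have h := DiffContOnCl.circleAverage (f := u) (c := 0) (R := 1) hu.diffContOnCl
    rw [Real.circleAverage_def] at h
    have h0 : u 0 = f 0 := by
      simp only [u, hfp]
      congr 1
      funext i
      simp [coord]
    have hc : ∀ t, u (circleMap 0 1 t) = f (J.rot t x) := fun t => by
      rw [hfr]; simp [u, circleMap]
    simp only [hc, h0] at h
    rw [← h, Complex.real_smul]
    push_cast
    rw [← mul_assoc, mul_inv_cancel₀ (by simp [Real.pi_ne_zero]), one_mul]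
  have hswap := intervalIntegral_integral_swap (μ := J.νL) hprod
  simp only [hrotI, havg] at hswap
  rw [intervalIntegral.integral_const, integral_const] at hswap
  have h2 : (2 * Real.pi : ℂ) ≠ 0 := by simp [Real.pi_ne_zero]
  refine mul_left_cancel₀ h2 ?_
  simpa using hswap

/-! #### The reproducing property -/

variable (J) in
/-- The holomorphic function `exp ({σ, x} / 2)`. -/
def expo (σ : L) (x : J.LHat) : ℂ := Complex.exp (1 / 2 * J.coord σ x)

variable (J) in
theorem isHolCylinder_expo (σ : L) : J.IsHolCylinder (J.expo σ) :=
  ⟨1, fun _ => σ, fun z => Complex.exp (1 / 2 * z 0), by fun_prop, fun _ => rfl⟩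

theorem IsAdmissible.memLp_expo (hJ : J.IsAdmissible) (σ : L) : MemLp (J.expo σ) 2 J.νL := by
  have h := hJ.isCanonicalGaussian.memLp_cexp ((1 / 2 : ℝ) • innerSL ℝ (J.toSpace σ))
    ((1 / 2 : ℝ) • innerSL ℝ (J.toSpace (J.J σ))) 0
  convert! h using 2 with x
  rw [expo, coord]
  congr 1
  simp
  ring

/-- The exponential is what remains of the reproducing kernel after translation by `ξ`; the product
must be holomorphic for the mean value property to apply. -/
theorem IsHolCylinder.translate_mul {f : J.LHat → ℂ} (hf : J.IsHolCylinder f) (ξ : L) :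
    J.IsHolCylinder fun x => Complex.exp (-(1 / 2 * J.coord ξ x)) * f (x + J.incl ξ) := by
  obtain ⟨n, σ, p, hp, hfp⟩ := hf
  refine ⟨n + 1, Fin.cons ξ σ, fun z => Complex.exp (-(1 / 2 * z 0)) *
    p (fun i => z i.succ + J.coord (σ i) (J.incl ξ)), ?_, fun x => ?_⟩
  · refine Differentiable.mul (by fun_prop) (hp.comp (by fun_prop))
  · simp only [hfp, coord_add, Fin.cons_zero, Fin.cons_succ]

/-- The value of a square-integrable holomorphic cylinder function at `ξ ∈ L` is its inner product
with `exp ({ξ, ·} / 2)`. -/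
theorem IsHolCylinder.integral_conj_expo_mul (hJ : J.IsAdmissible) {f : J.LHat → ℂ}
    (hf : J.IsHolCylinder f) (hf2 : MemLp f 2 J.νL) (ξ : L) :
    ∫ x, (starRingEnd ℂ) (J.expo ξ x) * f x ∂J.νL = f (J.incl ξ) := by
  have := hJ.complete
  have hG : Integrable (fun x => (starRingEnd ℂ) (J.expo ξ x) * f x) J.νL :=
    MemLp.integrable_mul (p := 2) (q := 2) (hJ.memLp_expo ξ).star hf2
  have hp := hJ.isCanonicalGaussian.measurePreserving_add_incl one_ne_zero (J.toSpace ξ)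
  have hGm := hG.1
  rw [← hp.map_eq] at hGm
  have hcomp := hp.integrable_comp_of_integrable hG
  have hmD : Measurable fun x : J.LHat => ENNReal.ofReal (Real.exp (-(x (innerSL ℝ (J.toSpace ξ)))
      / (1 : ℝ≥0) - inner ℝ (J.toSpace ξ) (J.toSpace ξ) / (2 * (1 : ℝ≥0)))) := by fun_prop
  rw [integrable_withDensity_iff_integrable_smul' hmD
    (ae_of_all _ fun _ => ENNReal.ofReal_lt_top)] at hcomp
  -- The Gaussian density cancels the antiholomorphic part of the translated conjugate exponential
  -- and leaves `exp (-{ξ, x} / 2)`, which is 1 at the origin.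
  have key : ∀ x : J.LHat, (ENNReal.ofReal (Real.exp (-(x (innerSL ℝ (J.toSpace ξ)))
      / (1 : ℝ≥0) - inner ℝ (J.toSpace ξ) (J.toSpace ξ) / (2 * (1 : ℝ≥0))))).toReal •
        ((starRingEnd ℂ) (J.expo ξ (x + J.incl ξ)) * f (x + J.incl ξ))
      = Complex.exp (-(1 / 2 * J.coord ξ x)) * f (x + J.incl ξ) := by
    intro x
    rw [ENNReal.toReal_ofReal (Real.exp_pos _).le, Complex.real_smul, ← mul_assoc, expo, coord_add,
      coord_incl_self, ← Complex.exp_conj, Complex.ofReal_exp, ← Complex.exp_add, inner_toSpace]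
    have h2 : (starRingEnd ℂ) 2 = 2 := map_ofNat _ 2
    congr 2
    simp [coord, h2]
    ring
  have hi : Integrable (fun x => Complex.exp (-(1 / 2 * J.coord ξ x)) * f (x + J.incl ξ)) J.νL :=
    hcomp.congr (ae_of_all _ key)
  have hmv := (hf.translate_mul ξ).integral_eq hJ hi
  rw [zero_add] at hmv
  have h0 : J.coord ξ 0 = 0 := by simp [coord]
  rw [h0, mul_zero, neg_zero, Complex.exp_zero, one_mul] at hmv
  rw [← hmv, ← integral_congr_ae (ae_of_all J.νL key)]
  conv_lhs => rw [← hp.map_eq]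
  rw [integral_map hp.measurable.aemeasurable hGm,
    integral_withDensity_eq_integral_toReal_smul hmD (ae_of_all _ fun _ => ENNReal.ofReal_lt_top)]
  rfl

end ComplexStructure

/-! ### Totality of the exponentials, restriction to `L`, and holomorphic coherent states. -/

namespace ComplexStructure

variable {J : ComplexStructure T}

theorem exists_coord_eq {V : Submodule ℝ L} [FiniteDimensional ℝ V] (hV : ∀ v ∈ V, J.J v ∈ V)
    (x : J.LHat) : ∃ w ∈ V, ∀ a ∈ V, J.coord a x = J.coord a (J.incl w) := by
  obtain ⟨y, ⟨w, hw, rfl⟩, h⟩ :=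
    Extension.exists_inner_eq (V.map J.toSpace.toLinearMap) x
  refine ⟨w, hw, fun a ha => ?_⟩
  have h' : ∀ b ∈ V, x (innerSL ℝ (J.toSpace b)) = J.incl w (innerSL ℝ (J.toSpace b)) :=
    fun b hb => h _ ⟨b, hb, rfl⟩
  rw [coord, coord, h' a ha, h' _ (hV a ha)]

theorem exists_finiteDimensional_invariant (J : ComplexStructure T) {n : ℕ} (σ : Fin n → L) :
    ∃ V : Submodule ℝ L, FiniteDimensional ℝ V ∧ (∀ v ∈ V, J.J v ∈ V) ∧ ∀ i, σ i ∈ V := by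
  refine ⟨Submodule.span ℝ (Set.range σ ∪ Set.range fun i => J.J (σ i)),
    FiniteDimensional.span_of_finite ℝ ((Set.finite_range _).union (Set.finite_range _)), ?_,
    fun i => Submodule.subset_span (Or.inl ⟨i, rfl⟩)⟩
  suffices h : Submodule.span ℝ (Set.range σ ∪ Set.range fun i => J.J (σ i)) ≤
      Submodule.comap J.J (Submodule.span ℝ (Set.range σ ∪ Set.range fun i => J.J (σ i))) from
    fun _ hv => h hv
  rw [Submodule.span_le]
  rintro _ (⟨i, rfl⟩ | ⟨i, rfl⟩)
  · exact Submodule.subset_span (Or.inr ⟨i, rfl⟩)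
  · rw [SetLike.mem_coe, Submodule.mem_comap, J.sq]
    exact neg_mem (Submodule.subset_span (Or.inl ⟨i, rfl⟩))

namespace IsAdmissible

variable (hJ : J.IsAdmissible)

/-- The function `exp ({σ, x} / 2)` as an element of `L²(L̂, ν_L)`. -/
def expoLp (σ : L) : Lp ℂ 2 J.νL := (hJ.memLp_expo σ).toLp

theorem inner_expoLp (σ : L) (F : Lp ℂ 2 J.νL) :
    inner ℂ (hJ.expoLp σ) F = ∫ x, (starRingEnd ℂ) (J.expo σ x) * F x ∂J.νL := by
  rw [L2.inner_def]
  refine integral_congr_ae ?_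
  filter_upwards [(hJ.memLp_expo σ).coeFn_toLp] with x h
  rw [expoLp, h, RCLike.inner_apply, mul_comm]

theorem inner_expoLp_eq {f : J.LHat → ℂ} {F : Lp ℂ 2 J.νL} (hf : J.IsHolCylinder f)
    (hF : F =ᵐ[J.νL] f) (ξ : L) : inner ℂ (hJ.expoLp ξ) F = f (J.incl ξ) := by
  have hf2 : MemLp f 2 J.νL := (memLp_congr_ae hF).1 (Lp.memLp F)
  rw [inner_expoLp, ← hf.integral_conj_expo_mul hJ hf2 ξ]
  refine integral_congr_ae ?_
  filter_upwards [hF] with x h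
  rw [h]

theorem inner_expoLp_expoLp (ξ σ : L) :
    inner ℂ (hJ.expoLp ξ) (hJ.expoLp σ) = J.expo σ (J.incl ξ) :=
  hJ.inner_expoLp_eq (J.isHolCylinder_expo σ) (hJ.memLp_expo σ).coeFn_toLp ξ

/-- A combination of exponentials `exp ({v, ·} / 2)` with `v` in a finite-dimensional invariant
subspace is a function of the coordinates in that subspace. -/
theorem exists_rep_of_mem_span {V : Submodule ℝ L} {F : Lp ℂ 2 J.νL}
    (hF : F ∈ Submodule.span ℂ (hJ.expoLp '' V)) :
    ∃ u : J.LHat → ℂ, F =ᵐ[J.νL] u ∧ (∀ ξ, inner ℂ (hJ.expoLp ξ) F = u (J.incl ξ)) ∧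
      ∀ x y : J.LHat, (∀ a ∈ V, J.coord a x = J.coord a y) → u x = u y := by
  induction hF using Submodule.span_induction with
  | mem F h =>
    obtain ⟨v, hv, rfl⟩ := h
    exact ⟨J.expo v, (hJ.memLp_expo v).coeFn_toLp, fun ξ => hJ.inner_expoLp_expoLp ξ v,
      fun x y h => by rw [expo, expo, h v hv]⟩
  | zero => exact ⟨0, Lp.coeFn_zero _ _ _, fun ξ => by simp, fun _ _ _ => rfl⟩
  | add F G _ _ hF hG =>
    obtain ⟨u, h1, h2, h3⟩ := hF
    obtain ⟨w, k1, k2, k3⟩ := hG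
    exact ⟨u + w, (Lp.coeFn_add _ _).trans (h1.add k1), fun ξ => by simp [inner_add_right, h2, k2],
      fun x y h => by simp [h3 x y h, k3 x y h]⟩
  | smul c F _ hF =>
    obtain ⟨u, h1, h2, h3⟩ := hF
    exact ⟨c • u, (Lp.coeFn_smul _ _).trans (h1.const_smul c),
      fun ξ => by simp [inner_smul_right, h2], fun x y h => by simp [h3 x y h]⟩

/-- Square-integrable holomorphic cylinder functions are approximated by combinations of
exponentials. -/
theorem mem_closure_span_expoLp {f : J.LHat → ℂ} {F : Lp ℂ 2 J.νL} (hf : J.IsHolCylinder f)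
    (hF : F =ᵐ[J.νL] f) : F ∈ (Submodule.span ℂ (Set.range hJ.expoLp)).topologicalClosure := by
  obtain ⟨n, σ, p, hp, hfp⟩ := id hf
  obtain ⟨V, hVfin, hVJ, hσ⟩ := J.exists_finiteDimensional_invariant σ
  -- Restricting to a finite-dimensional invariant `V` makes pointwise evaluation meaningful: on the
  -- coordinates in `V` every `x` agrees with some `w ∈ V`. It then suffices that the projection of
  -- `F` to `G` has the values of `f` on `V`, which the reproducing property gives.
  set G := (Submodule.span ℂ (hJ.expoLp '' V)).topologicalClosure with hG
  have hGc : CompleteSpace G :=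
    (Submodule.isClosed_topologicalClosure _).completeSpace_coe
  set P : Lp ℂ 2 J.νL := G.starProjection F with hP
  have hPG : P ∈ G := Submodule.starProjection_apply_mem _ _
  have hinner : ∀ v ∈ V, inner ℂ (hJ.expoLp v) P = f (J.incl v) := fun v hv => by
    rw [← hJ.inner_expoLp_eq hf hF v, ← sub_eq_zero, ← inner_sub_right, ← neg_eq_zero,
      ← inner_neg_right, neg_sub]
    exact (Submodule.mem_orthogonal _ _).1 (Submodule.sub_starProjection_mem_orthogonal F) _
      (Submodule.le_topologicalClosure _ (Submodule.subset_span ⟨v, hv, rfl⟩))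
  obtain ⟨Fk, hFk, hlim⟩ := mem_closure_iff_seq_limit.1 hPG
  choose u hu1 hu2 hu3 using fun k => hJ.exists_rep_of_mem_span (hFk k)
  -- At almost every `x` a subsequence of approximants converges to `P x`. Their values at `x` are
  -- those at `w`, which are inner products with `exp ({w, ·} / 2)` and hence tend to `f w = f x`.
  obtain ⟨ns, hns, hae⟩ := (tendstoInMeasure_of_tendsto_Lp hlim).exists_seq_tendsto_ae
  have hPF : P = F := by
    refine Lp.ext ?_
    filter_upwards [hae, ae_all_iff.2 hu1, hF] with x h1 h2 h3
    rw [h3]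
    simp only [h2] at h1
    refine tendsto_nhds_unique h1 ?_
    obtain ⟨w, hw, hwx⟩ := exists_coord_eq hVJ x
    have hfx : f x = f (J.incl w) := by
      rw [hfp, hfp]
      congr 1
      funext i
      exact hwx _ (hσ i)
    rw [hfx, ← hinner w hw]
    simp only [hu3 _ x (J.incl w) hwx, ← hu2]
    exact ((tendsto_const_nhds (x := hJ.expoLp w)).inner hlim).comp hns.tendsto_atTop
  rw [← hPF]
  exact Submodule.topologicalClosure_mono (Submodule.span_mono (Set.image_subset_range _ _)) hPG

theorem expoLp_mem_H2 (σ : L) : hJ.expoLp σ ∈ J.H2 :=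
  Submodule.le_topologicalClosure _ (Submodule.subset_span
    ⟨_, J.isHolCylinder_expo σ, (hJ.memLp_expo σ).coeFn_toLp⟩)

theorem H2_eq : J.H2 = (Submodule.span ℂ (Set.range hJ.expoLp)).topologicalClosure := by
  refine le_antisymm ?_ ?_
  · refine Submodule.topologicalClosure_minimal _ (Submodule.span_le.2 ?_)
      (Submodule.isClosed_topologicalClosure _)
    rintro F ⟨f, hf, hF⟩
    exact hJ.mem_closure_span_expoLp hf hF
  · refine Submodule.topologicalClosure_minimal _ (Submodule.span_le.2 ?_)
      (Submodule.isClosed_topologicalClosure _)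
    rintro _ ⟨σ, rfl⟩
    exact hJ.expoLp_mem_H2 σ

/-- The restriction to `L` of a holomorphic function is given by inner products with exponentials. -/
theorem isRestriction_iff {F : Lp ℂ 2 J.νL} {h : L → ℂ} :
    J.IsRestriction F h ↔ F ∈ J.H2 ∧ ∀ ξ, h ξ = inner ℂ (hJ.expoLp ξ) F := by
  constructor
  · rintro ⟨f, hf, hf2, hlim, hh⟩
    have hF : (Lp.memLp F).toLp (⇑F) = F := Lp.toLp_coeFn F (Lp.memLp F)
    have hlim' : Tendsto (fun k => (hf2 k).toLp (f k)) atTop (𝓝 F) := by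
      rw [← hF, Lp.tendsto_Lp_iff_tendsto_eLpNorm'']
      exact hlim
    refine ⟨?_, fun ξ => tendsto_nhds_unique (hh ξ) ?_⟩
    · exact (Submodule.isClosed_topologicalClosure _).mem_of_tendsto hlim'
        (Eventually.of_forall fun k => Submodule.le_topologicalClosure _
          (Submodule.subset_span ⟨f k, hf k, (hf2 k).coeFn_toLp⟩))
    · have := (tendsto_const_nhds (x := hJ.expoLp ξ)).inner (𝕜 := ℂ) hlim'
      simpa only [fun k => hJ.inner_expoLp_eq (hf k) (hf2 k).coeFn_toLp ξ] using this
  · rintro ⟨hF, hh⟩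
    -- Cylinder functions are closed under linear combinations, so the approximants in the span are
    -- themselves cylinder functions, as a restriction requires.
    have hspan : ∀ G ∈ Submodule.span ℂ {F : Lp ℂ 2 J.νL | ∃ f, J.IsHolCylinder f ∧ F =ᵐ[J.νL] f},
        ∃ f, J.IsHolCylinder f ∧ G =ᵐ[J.νL] f := by
      intro G hG
      induction hG using Submodule.span_induction with
      | mem G h => exact h
      | zero => exact ⟨fun _ => 0, ⟨0, Fin.elim0, 0, by fun_prop, fun _ => rfl⟩, Lp.coeFn_zero _ _ _⟩
      | add F G _ _ hF hG =>
        obtain ⟨f, h1, h2⟩ := hF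
        obtain ⟨g, k1, k2⟩ := hG
        exact ⟨f + g, h1.add J k1, (Lp.coeFn_add _ _).trans (h2.add k2)⟩
      | smul c F _ hF =>
        obtain ⟨f, h1, h2⟩ := hF
        exact ⟨c • f, h1.smul J c, (Lp.coeFn_smul _ _).trans (h2.const_smul c)⟩
    obtain ⟨Fk, hFk, hlim⟩ := mem_closure_iff_seq_limit.1 hF
    choose f hf hfF using fun k => hspan (Fk k) (hFk k)
    refine ⟨f, hf, fun k => (memLp_congr_ae (hfF k)).1 (Lp.memLp _), ?_, fun ξ => ?_⟩
    · refine ((Lp.tendsto_Lp_iff_tendsto_eLpNorm' Fk F).1 hlim).congr fun k => ?_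
      exact eLpNorm_congr_ae ((hfF k).sub EventuallyEq.rfl)
    · simp only [fun k => (hJ.inner_expoLp_eq (hf k) (hfF k) ξ).symm, hh]
      exact (tendsto_const_nhds (x := hJ.expoLp ξ)).inner hlim

/-- The `η`-reduced wave function of the holomorphic coherent state of `τ`. -/
def reducedCoherent (η τ : A) : J.H2 :=
  ⟨(starRingEnd ℂ) (J.α η τ) • hJ.expoLp (τ -ᵥ η), J.H2.smul_mem _ (hJ.expoLp_mem_H2 _)⟩

theorem inner_reducedCoherent (η ζ : A) (F : J.H2) :
    inner ℂ (hJ.reducedCoherent η ζ) F = inner ℂ (hJ.expoLp (ζ -ᵥ η)) (F : Lp ℂ 2 J.νL)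
      * J.α η ζ := by
  rw [Submodule.coe_inner, reducedCoherent, inner_smul_left, Complex.conj_conj, mul_comm]

/-- The conjugate phase in `reducedCoherent` is chosen for this: evaluating a wave function at `ζ`
becomes an inner product with the coherent state of `ζ`. -/
theorem represents_iff {η : A} {ψ : A → ℂ} {F : J.H2} :
    J.Represents η ψ F ↔ ∀ ζ, ψ ζ = inner ℂ (hJ.reducedCoherent η ζ) F := by
  constructor
  · rintro ⟨h, hF, hψ⟩ ζ
    rw [hψ, inner_reducedCoherent, ((hJ.isRestriction_iff).1 hF).2]
  · intro h
    refine ⟨fun ξ => inner ℂ (hJ.expoLp ξ) (F : Lp ℂ 2 J.νL),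
      (hJ.isRestriction_iff).2 ⟨F.2, fun _ => rfl⟩, fun ζ => ?_⟩
    rw [h, inner_reducedCoherent]

/-- The Gram matrix of the holomorphic coherent states. -/
theorem inner_reducedCoherent_reducedCoherent (η ζ ζ' : A) :
    inner ℂ (hJ.reducedCoherent η ζ) (hJ.reducedCoherent η ζ') = J.coherent ζ' ζ := by
  rw [inner_reducedCoherent, reducedCoherent, inner_smul_right, inner_expoLp_expoLp, expo,
    coord_incl, α, α, coherent, ← Complex.exp_conj, ← Complex.exp_add, ← Complex.exp_add,
    T.θ_eq η ζ, T.θ_eq η ζ', T.θ_eq η ζ', T.θ_eq η ζ, ← vsub_sub_vsub_cancel_right ζ ζ' η]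
  generalize ζ -ᵥ η = v
  generalize ζ' -ᵥ η = w
  have h2 : (starRingEnd ℂ) 2 = 2 := map_ofNat _ 2
  have h4 : (starRingEnd ℂ) 4 = 4 := map_ofNat _ 4
  have hω : T.ω w v = 1 / 2 * (T.bracket w v - T.bracket v w) := rfl
  congr 1
  simp only [hω, J.g.symm w v, map_sub, LinearMap.sub_apply, map_add, map_mul, map_div₀,
    Complex.conj_I, Complex.conj_ofReal, map_one, h2, h4]
  push_cast
  ring

/-- The holomorphic coherent states are total. -/
theorem span_reducedCoherent (η : A) :
    (Submodule.span ℂ (Set.range (hJ.reducedCoherent η))).topologicalClosure = ⊤ := by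
  have hc : CompleteSpace J.H2 := (Submodule.isClosed_topologicalClosure _).completeSpace_coe
  rw [Submodule.topologicalClosure_eq_top_iff, Submodule.eq_bot_iff]
  intro F hF
  have horth : ∀ ξ, inner ℂ (hJ.expoLp ξ) (F : Lp ℂ 2 J.νL) = 0 := fun ξ => by
    have h := (Submodule.mem_orthogonal _ _).1 hF _ (Submodule.subset_span ⟨ξ +ᵥ η, rfl⟩)
    rw [inner_reducedCoherent, vadd_vsub] at h
    exact (mul_eq_zero.1 h).resolve_right (Complex.exp_ne_zero _)
  have hF' : (F : Lp ℂ 2 J.νL) ∈ (Submodule.span ℂ (Set.range hJ.expoLp)).topologicalClosure := by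
    rw [← hJ.H2_eq]; exact F.2
  -- Vectors orthogonal to `F` form a closed subspace containing all exponentials, hence all of
  -- `H²`, including `F` itself.
  have hle : (Submodule.span ℂ (Set.range hJ.expoLp)).topologicalClosure
      ≤ (Submodule.span ℂ {(F : Lp ℂ 2 J.νL)})ᗮ := by
    refine Submodule.topologicalClosure_minimal _ (Submodule.span_le.2 ?_)
      (Submodule.isClosed_orthogonal _)
    rintro _ ⟨ξ, rfl⟩
    rw [SetLike.mem_coe, Submodule.mem_orthogonal_singleton_iff_inner_left]
    exact horth ξ
  have := Submodule.mem_orthogonal_singleton_iff_inner_left.1 (hle hF')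
  exact Subtype.ext (inner_self_eq_zero.1 this)

end IsAdmissible

end ComplexStructure

/-! ### Total families with equal Gram matrices in abstract Hilbert spaces. -/

theorem denseRange_linearCombination {ι K : Type*} [NormedAddCommGroup K] [InnerProductSpace ℂ K]
    {c : ι → K} (hc : (Submodule.span ℂ (Set.range c)).topologicalClosure = ⊤) :
    DenseRange (Finsupp.linearCombination ℂ c) := by
  rw [← Finsupp.range_linearCombination, ← Submodule.dense_iff_topologicalClosure_eq_top] at hc
  exact hc

theorem inner_linearCombination {ι K : Type*} [NormedAddCommGroup K] [InnerProductSpace ℂ K]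
    (c : ι → K) (x y : ι →₀ ℂ) :
    inner ℂ (Finsupp.linearCombination ℂ c x) (Finsupp.linearCombination ℂ c y) =
      x.sum fun i s => y.sum fun j t => (starRingEnd ℂ) s * (t * inner ℂ (c i) (c j)) := by
  simp only [Finsupp.linearCombination_apply, Finsupp.sum, sum_inner, inner_sum, inner_smul_left,
    inner_smul_right, Finset.mul_sum]
  rw [Finset.sum_comm]
  exact Finset.sum_congr rfl fun i _ => Finset.sum_congr rfl fun j _ => by ring

/-- Two total families with the same Gram matrix are related by an isometric isomorphism. -/
theorem exists_linearIsometryEquiv_of_inner_eq {ι H H' : Type*} [NormedAddCommGroup H]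
    [InnerProductSpace ℂ H] [CompleteSpace H] [NormedAddCommGroup H'] [InnerProductSpace ℂ H']
    [CompleteSpace H'] {a : ι → H} {b : ι → H'}
    (ha : (Submodule.span ℂ (Set.range a)).topologicalClosure = ⊤)
    (hb : (Submodule.span ℂ (Set.range b)).topologicalClosure = ⊤)
    (hab : ∀ i j, inner ℂ (b i) (b j) = inner ℂ (a i) (a j)) :
    ∃ U : H ≃ₗᵢ[ℂ] H', ∀ i, U (a i) = b i := by
  -- The norm of a finite combination depends only on the Gram matrix, so matching combinations is
  -- isometric on dense ranges and extends.
  have hn : ∀ x : ι →₀ ℂ, ‖Finsupp.linearCombination ℂ b (LinearEquiv.refl ℂ (ι →₀ ℂ) x)‖ =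
      ‖Finsupp.linearCombination ℂ a x‖ := fun x => by
    rw [LinearEquiv.refl_apply, norm_eq_sqrt_re_inner (𝕜 := ℂ),
      norm_eq_sqrt_re_inner (𝕜 := ℂ) (Finsupp.linearCombination ℂ a x),
      inner_linearCombination, inner_linearCombination]
    simp only [hab]
  refine ⟨(LinearEquiv.refl ℂ (ι →₀ ℂ)).extendOfIsometry (Finsupp.linearCombination ℂ a)
    (Finsupp.linearCombination ℂ b) (denseRange_linearCombination ha)
    (denseRange_linearCombination hb) hn, fun i => ?_⟩
  have := LinearEquiv.extendOfIsometry_eq (LinearEquiv.refl ℂ (ι →₀ ℂ))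
    (Finsupp.linearCombination ℂ a) (Finsupp.linearCombination ℂ b)
    (denseRange_linearCombination ha) (denseRange_linearCombination hb) hn (Finsupp.single i 1)
  simpa using this

theorem eq_of_inner_eq_of_total {ι K : Type*} [NormedAddCommGroup K] [InnerProductSpace ℂ K]
    [CompleteSpace K] {c : ι → K} (hc : (Submodule.span ℂ (Set.range c)).topologicalClosure = ⊤)
    {x y : K} (h : ∀ i, inner ℂ (c i) x = inner ℂ (c i) y) : x = y := by
  rw [Submodule.topologicalClosure_eq_top_iff, Submodule.eq_bot_iff] at hc
  rw [← sub_eq_zero]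
  have hle : Submodule.span ℂ (Set.range c) ≤ (Submodule.span ℂ {x - y})ᗮ := by
    rw [Submodule.span_le]
    rintro _ ⟨i, rfl⟩
    rw [SetLike.mem_coe, Submodule.mem_orthogonal_singleton_iff_inner_left, inner_sub_right, h,
      sub_self]
  exact hc _ ((Submodule.mem_orthogonal _ _).2 fun u hu =>
    Submodule.mem_orthogonal_singleton_iff_inner_left.1 (hle hu))

end AffineFieldTheory

end

/-! ### Assembly of the isomorphism. -/

/-- The Hilbert space structures on the two state spaces are those for which passing to the
representative at a base point `η` is unitary, onto `L²(Q̂, ν_Q)` by `S η` and onto `H²(L̂, ν_L)` by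
`H η`; it is part of the claim that `S η` and `H η` are bijections and that the norms do not depend
on `η`. The map `B` is the isometric isomorphism. -/
theorem mainTheorem1 {L A : Type*} [AddCommGroup L] [Module ℝ L] [AddTorsor L A]
    (T : Theory L A) (Ω : VacuumForm T) (hΩ : Ω.IsAdmissible) :
    (∃! J : ComplexStructure T, J.IsAdmissible ∧ J.Corresponds Ω) ∧
    ∀ J : ComplexStructure T, J.IsAdmissible → J.Corresponds Ω →
      ∃ (S : A → hΩ.stateSpace ≃ₗ[ℂ] MeasureTheory.Lp ℂ 2 Ω.νQ)
        (H : A → J.stateSpace ≃ₗ[ℂ] J.H2)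
        (B : hΩ.stateSpace ≃ₗ[ℂ] J.stateSpace),
        (∀ η Ψ, S η Ψ = (Ψ : A → MeasureTheory.Lp ℂ 2 Ω.νQ) η) ∧
        (∀ η ψ F, H η ψ = F ↔ J.Represents η ψ F) ∧
        (∀ η η' Ψ, ‖S η Ψ‖ = ‖S η' Ψ‖) ∧
        (∀ η η' ψ, ‖H η ψ‖ = ‖H η' ψ‖) ∧
        (∀ η Ψ, ‖H η (B Ψ)‖ = ‖S η Ψ‖) ∧
        ∀ τ, ∃ Ψ : hΩ.stateSpace, (∀ η, S η Ψ =ᵐ[Ω.νQ] hΩ.coherent τ η) ∧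
          (B Ψ : A → ℂ) = J.coherent τ := by
  refine ⟨hΩ.existsUnique_complexStructure, fun J hJ hJΩ => ?_⟩
  have hc : CompleteSpace J.H2 := (Submodule.isClosed_topologicalClosure _).completeSpace_coe
  obtain ⟨η₀⟩ : Nonempty A := AddTorsor.nonempty
  let a : A → Lp ℂ 2 Ω.νQ := fun τ => hΩ.reduce η₀ (hΩ.coherentState τ)
  have ha := hΩ.span_reduce_coherentState η₀
  have hU : ∀ η, ∃ U : Lp ℂ 2 Ω.νQ ≃ₗᵢ[ℂ] J.H2, ∀ τ, U (a τ) = hJ.reducedCoherent η τ := fun η =>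
    exists_linearIsometryEquiv_of_inner_eq ha (hJ.span_reducedCoherent η) fun ζ ζ' => by
      rw [hJ.inner_reducedCoherent_reducedCoherent, hΩ.inner_reduce_coherentState hJΩ]
  choose U hU using hU
  -- The transform `F ↦ (ζ ↦ ⟨K_ζ, F⟩)` involves no holomorphic base point, while `U η` gives its
  -- reduced wave function at each `η`. As every `U η` is isometric, the norm on the image cannot
  -- depend on `η`.
  let W : Lp ℂ 2 Ω.νQ →ₗ[ℂ] A → ℂ := LinearMap.pi fun ζ => (innerSL ℂ (a ζ)).toLinearMap
  have hrep : ∀ η F (G : J.H2), J.Represents η (W F) G ↔ U η F = G := fun η F G => by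
    rw [hJ.represents_iff]
    constructor
    · intro h
      refine eq_of_inner_eq_of_total (hJ.span_reducedCoherent η) fun ζ => ?_
      rw [← h, ← hU, LinearIsometryEquiv.inner_map_map]
      rfl
    · rintro rfl ζ
      rw [← hU, LinearIsometryEquiv.inner_map_map]
      rfl
  have hWmem : ∀ F, W F ∈ J.stateSpace := fun F η => ⟨U η F, (U η F).2, (hrep η F _).2 rfl⟩
  let E : Lp ℂ 2 Ω.νQ ≃ₗ[ℂ] J.stateSpace :=
    LinearEquiv.ofBijective (W.codRestrict J.stateSpace hWmem) <| by
      refine ⟨fun F G h => ?_, fun ψ => ?_⟩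
      · have h' : W F = W G := congrArg Subtype.val h
        exact eq_of_inner_eq_of_total ha fun ζ => congrFun h' ζ
      · obtain ⟨F, hF, hψ⟩ := ψ.2 η₀
        -- A representative at the single base point `η₀` already determines the wave function, so
        -- it suffices to invert `U η₀`.
        refine ⟨(U η₀).symm ⟨F, hF⟩, Subtype.ext (funext fun ζ => ?_)⟩
        have h1 := (hJ.represents_iff (F := ⟨F, hF⟩)).1 hψ ζ
        have h2 := (hJ.represents_iff (F := ⟨F, hF⟩)).1
          ((hrep η₀ ((U η₀).symm ⟨F, hF⟩) ⟨F, hF⟩).2 (by simp)) ζ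
        exact h2.trans h1.symm
  have hE : ∀ F, (E F : A → ℂ) = W F := fun F => rfl
  refine ⟨hΩ.reduce, fun η => E.symm ≪≫ₗ (U η).toLinearEquiv, hΩ.reduce η₀ ≪≫ₗ E,
    fun η Ψ => rfl, fun η ψ F => ?_, fun η η' Ψ => hΩ.norm_reduce η η' Ψ, fun η η' ψ => ?_,
    fun η Ψ => ?_, fun τ => ⟨hΩ.coherentState τ, hΩ.reduce_coherentState_ae τ, ?_⟩⟩
  · obtain ⟨G, rfl⟩ := E.surjective ψ
    rw [hE, hrep]
    simp
  · simp
  · rw [hΩ.norm_reduce η η₀]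
    simp
  · funext ζ
    exact hΩ.inner_reduce_coherentState hJΩ η₀ ζ τ
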